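/- Let $f:\mathbb P^1\to\mathbb P^1$ be the quartic polynomial $f(z)=2i\bigl(z^2-\tfrac{1+i}{2}\bigr)^2$, with $f(\infty)=\infty$, and let $P_f=\bigcup_{n>0}f^{\circ n}(\Omega_f)$ be its postcritical set, where $\Omega_f$ is the set of critical points (the points where $f$ is not locally injective); in fact $P_f=\{0,1,-1,\infty\}$. Let $\mathrm{PMCG}(\mathbb P^1,P_f)$ be the pure mapping class group, that is, the group of orientation-preserving homeomorphisms of $\mathbb P^1$ fixing $P_f$ pointwise modulo the subgroup of those isotopic to the identity relative to $P_f$. Let $D\subset\mathbb C$ be a small regular neighbourhood of the segment $[0,1]$, that is, a closed topological disc with $[0,1]$ in its interior and $-1\notin D$, and let $\gamma_0=\partial D$. Let $h_0$ be a right Dehn twist about $\gamma_0$ (supported in an annular neighbourhood of $\gamma_0$ disjoint from $P_f$), or more generally any orientation-preserving homeomorphism fixing $P_f$ pointwise that represents the class of such a twist in $\mathrm{PMCG}(\mathbb P^1,P_f)$. Such $D$ and such Dehn twists exist. If $h_1:\mathbb P^1\to\mathbb P^1$ is any map with $h_0\circ f=f\circ h_1$ (a lift of $h_0$ under $f$),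 then $h_1$ does not represent an element of $\mathrm{PMCG}(\mathbb P^1,P_f)$: it is not an orientation-preserving homeomorphism fixing $P_f$ pointwise. On the other hand, Thurston's linear map $\lambda_f:\mathbb R[\mathcal S]\to\mathbb R[\mathcal S]$ is constant. Here $\mathcal S$ is the set of free homotopy classes in $\mathbb P^1-P_f$ of unoriented simple closed curves $\gamma\subset\mathbb P^1-P_f$ such that each component of $\mathbb P^1-\gamma$ contains at least two points of $P_f$, and $\lambda_f([\gamma])=\sum_{[\gamma_i]\in\mathcal S} d_i[\gamma_i]$ with $d_i=\sum_{\delta}1/\deg(\delta\to\gamma)$, the sum being over the components $\delta$ of $f^{-1}(\gamma)$ homotopic to $\gamma_i$ in $\mathbb P^1-P_f$. Thus constancy of $\lambda_f$ does not imply that every Dehn twist lifts under $f$ to a pure mapping class. -/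

import Mathlib

open Set Filter Topology CategoryTheory
open scoped Real

noncomputable section

namespace DehnTwistLift

/-- The Riemann sphere `ℙ¹ = ℂ ∪ {∞}`. -/
abbrev P1 : Type := OnePoint ℂ

/-! ### Branched covers and their postcritical sets -/

/-- The critical points of a branched cover: the points where it is not locally injective. -/
def criticalPoints (f : P1 → P1) : Set P1 :=
  {x | ¬ ∃ U ∈ 𝓝 x, InjOn f U}

/-- The postcritical set `P_f = ⋃_{n > 0} fⁿ(Ω_f)`. -/
def postcriticalSet (f : P1 → P1) : Set P1 :=
  ⋃ n : ℕ, f^[n + 1] '' criticalPoints f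

/-- The quartic polynomial `f(z) = 2i (z² - (1+i)/2)²`, extended by `f(∞) = ∞`. -/
def quartic : P1 → P1 :=
  OnePoint.map fun z : ℂ => 2 * Complex.I * (z ^ 2 - (1 + Complex.I) / 2) ^ 2

/-- The postcritical set of the quartic. -/
abbrev Pf : Set P1 := postcriticalSet quartic

/-! ### The pure mapping class group -/

/-- A homeomorphism of the sphere preserves orientation if it acts as the identity on
`H₂(ℙ¹; ℤ)`, that is, if its degree is `1`. -/
def IsOrientationPreserving (h : P1 ≃ₜ P1) : Prop :=
  ((AlgebraicTopology.singularHomologyFunctor (ModuleCat.{0} ℤ) 2).obj (ModuleCat.of ℤ ℤ)).map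
    (TopCat.ofHom (h : C(P1, P1))) = 𝟙 _

theorem isOrientationPreserving_one : IsOrientationPreserving 1 :=
  CategoryTheory.Functor.map_id _ (TopCat.of P1)

theorem IsOrientationPreserving.mul {h k : P1 ≃ₜ P1} (hh : IsOrientationPreserving h)
    (hk : IsOrientationPreserving k) : IsOrientationPreserving (h * k) := by
  have e : TopCat.ofHom ((h * k : P1 ≃ₜ P1) : C(P1, P1)) =
      TopCat.ofHom (k : C(P1, P1)) ≫ TopCat.ofHom (h : C(P1, P1)) := rfl
  unfold IsOrientationPreserving at *
  rw [e, Functor.map_comp, hh, hk, Category.comp_id]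

theorem IsOrientationPreserving.inv {h : P1 ≃ₜ P1} (hh : IsOrientationPreserving h) :
    IsOrientationPreserving h⁻¹ := by
  have e : TopCat.ofHom ((h⁻¹ : P1 ≃ₜ P1) : C(P1, P1)) ≫ TopCat.ofHom (h : C(P1, P1)) =
      𝟙 (TopCat.of P1) := by
    ext x
    exact h.apply_symm_apply x
  unfold IsOrientationPreserving at *
  have := congrArg (((AlgebraicTopology.singularHomologyFunctor
    (ModuleCat.{0} ℤ) 2).obj (ModuleCat.of ℤ ℤ)).map) e
  rw [Functor.map_comp, hh, Category.comp_id] at this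
  exact this.trans (CategoryTheory.Functor.map_id _ _)

/-- The group of orientation-preserving homeomorphisms of `ℙ¹` fixing `P` pointwise. -/
def pureHomeo (P : Set P1) : Subgroup (P1 ≃ₜ P1) where
  carrier := {h | IsOrientationPreserving h ∧ ∀ p ∈ P, h p = p}
  one_mem' := ⟨isOrientationPreserving_one, fun _ _ => rfl⟩
  mul_mem' := by
    rintro a b ⟨ha, ha'⟩ ⟨hb, hb'⟩
    refine ⟨ha.mul hb, fun p hp => ?_⟩
    change a (b p) = p
    rw [hb' p hp, ha' p hp]
  inv_mem' := by
    rintro a ⟨ha, ha'⟩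
    refine ⟨ha.inv, fun p hp => ?_⟩
    change a.symm p = p
    rw [Homeomorph.symm_apply_eq, ha' p hp]

/-- `H` is an isotopy relative to `P` from the identity to `h`. -/
structure IsIsotopyFromId (P : Set P1) (h : P1 → P1) (H : unitInterval × P1 → P1) : Prop where
  continuous : Continuous H
  zero : ∀ x, H (0, x) = x
  one : ∀ x, H (1, x) = h x
  homeo : ∀ t, IsHomeomorph fun x => H (t, x)
  fixes : ∀ t, ∀ p ∈ P, H (t, p) = p

theorem IsIsotopyFromId.inv {P : Set P1} {h : P1 ≃ₜ P1} {H : unitInterval × P1 → P1}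
    (hH : IsIsotopyFromId P h H) : ∃ K, IsIsotopyFromId P h.symm K := by
  have hb : IsHomeomorph fun q : unitInterval × P1 => (q.1, H q) := by
    rw [isHomeomorph_iff_continuous_bijective]
    refine ⟨continuous_fst.prodMk hH.continuous, ?_, ?_⟩
    · rintro ⟨t, x⟩ ⟨t', x'⟩ hq
      simp only [Prod.mk.injEq] at hq
      obtain ⟨rfl, h2⟩ := hq
      rw [(hH.homeo t).injective h2]
    · rintro ⟨t, y⟩
      obtain ⟨x, hx⟩ := (hH.homeo t).surjective y
      exact ⟨(t, x), Prod.ext rfl hx⟩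
  let e := hb.homeomorph
  have he : ∀ t x, e (t, x) = (t, H (t, x)) := fun _ _ => rfl
  have hs : ∀ t x, e.symm (t, H (t, x)) = (t, x) := fun t x => by
    rw [← he, e.symm_apply_apply]
  have hs2 : ∀ t y, H (t, (e.symm (t, y)).2) = y := fun t y => by
    obtain ⟨x, rfl⟩ := (hH.homeo t).surjective y
    simp only [hs]
  refine ⟨fun q => (e.symm q).2, ⟨continuous_snd.comp e.symm.continuous, fun x => ?_, fun x => ?_,
    fun t => ?_, fun t p hp => ?_⟩⟩
  · have := hs 0 x
    rw [hH.zero] at this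
    simp [this]
  · have := hs 1 (h.symm x)
    rw [hH.one, h.apply_symm_apply] at this
    simp [this]
  · rw [isHomeomorph_iff_continuous_bijective]
    refine ⟨continuous_snd.comp (e.symm.continuous.comp (by fun_prop)), fun x y hxy => ?_,
      fun x => ⟨H (t, x), by simp only [hs]⟩⟩
    have := congrArg (fun z => H (t, z)) hxy
    simpa only [hs2] using this
  · have := hs t p
    rw [hH.fixes t p hp] at this
    simp [this]

/-- The subgroup of those pure homeomorphisms that are isotopic to the identity relative
to `P`. -/
def isotopicToId (P : Set P1) : Subgroup (pureHomeo P) where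
  carrier := {h | ∃ H, IsIsotopyFromId P (h : P1 ≃ₜ P1) H}
  one_mem' := ⟨fun q => q.2, continuous_snd, fun _ => rfl, fun _ => rfl,
    fun _ => IsHomeomorph.id, fun _ _ _ => rfl⟩
  mul_mem' := by
    rintro a b ⟨H, hH⟩ ⟨K, hK⟩
    refine ⟨fun q => H (q.1, K q), ⟨hH.continuous.comp (continuous_fst.prodMk hK.continuous),
      fun x => ?_, fun x => ?_, fun t => (hH.homeo t).comp (hK.homeo t), fun t p hp => ?_⟩⟩
    · simp only [hK.zero, hH.zero]
    · simp only [hK.one, hH.one]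
      rfl
    · simp only [hK.fixes t p hp, hH.fixes t p hp]
  inv_mem' := by
    rintro a ⟨H, hH⟩
    exact hH.inv

instance (P : Set P1) : (isotopicToId P).Normal where
  conj_mem := by
    rintro a ⟨H, hH⟩ g
    refine ⟨fun q => (g : P1 ≃ₜ P1) (H (q.1, (g : P1 ≃ₜ P1).symm q.2)),
      ⟨(g : P1 ≃ₜ P1).continuous.comp (hH.continuous.comp (continuous_fst.prodMk
        ((g : P1 ≃ₜ P1).symm.continuous.comp continuous_snd))), fun x => ?_, fun x => ?_,
      fun t => ((g : P1 ≃ₜ P1).isHomeomorph.comp (hH.homeo t)).comp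
        (g : P1 ≃ₜ P1).symm.isHomeomorph, fun t p hp => ?_⟩⟩
    · simp only [hH.zero, Homeomorph.apply_symm_apply]
    · simp only [hH.one]
      rfl
    · have h1 : (g : P1 ≃ₜ P1).symm p = p := (Homeomorph.symm_apply_eq _).2 (g.2.2 p hp).symm
      simp only [h1, hH.fixes t p hp, g.2.2 p hp]

/-- The pure mapping class group `PMCG(ℙ¹, P)`. -/
abbrev PMCG (P : Set P1) : Type := pureHomeo P ⧸ isotopicToId P

/-- The class of a pure homeomorphism in the pure mapping class group. -/
def mappingClass (P : Set P1) (h : pureHomeo P) : PMCG P := QuotientGroup.mk h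

/-! ### Dehn twists -/

/-- The closed round annulus `1 ≤ |z| ≤ 2`. -/
def annulus : Set ℂ := {z | 1 ≤ ‖z‖ ∧ ‖z‖ ≤ 2}

/-- The standard right twist `(r, θ) ↦ (r, θ - 2π (r - 1))` of the annulus `1 ≤ r ≤ 2`; an arc
that crosses the annulus turns to the right under it. -/
def stdRightTwist (z : ℂ) : ℂ :=
  z * Complex.exp (-(2 * π * (‖z‖ - 1) : ℝ) * Complex.I)

/-- A local homeomorphism `g` from the plane to the sphere, finite at `z`, preserves orientation
at `z`: the images of small counterclockwise circles about `z` have winding number `+1` about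
`g z`. The winding number is expressed by a continuous branch `ℓ` of `log (g - g z)` along the
circle, which increases by `2πi` in one turn. -/
def PreservesOrientationAt (g : ℂ → P1) (z : ℂ) : Prop :=
  ∃ w : ℂ, g z = (w : P1) ∧ ∀ᶠ r in 𝓝[>] (0 : ℝ), ∃ ℓ : ℝ → ℂ, Continuous ℓ ∧
    (∀ t, g (circleMap z r t) = ((w + Complex.exp (ℓ t) : ℂ) : P1)) ∧
    ∀ t, ℓ (t + 2 * π) = ℓ t + 2 * π * Complex.I

/-- `h` is a right Dehn twist of `(ℙ¹, P)` about the simple closed curve `γ`: there is an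
orientation-preserving parametrization `φ` of an annular neighbourhood of `γ` disjoint from `P`,
with core curve `γ`, such that `h` is the standard right twist in the coordinates `φ`, and the
identity outside the annulus. -/
def IsRightDehnTwist (P : Set P1) (γ : Set P1) (h : P1 → P1) : Prop :=
  ∃ φ : OpenPartialHomeomorph ℂ P1,
    annulus ⊆ φ.source ∧
    (∀ z ∈ annulus, φ z ≠ OnePoint.infty → PreservesOrientationAt φ z) ∧
    φ '' Metric.sphere (0 : ℂ) (3 / 2) = γ ∧
    Disjoint (φ '' annulus) P ∧
    (∀ z ∈ annulus, h (φ z) = φ (stdRightTwist z)) ∧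
    ∀ x, x ∉ φ '' annulus → h x = x

/-- `D` is a small regular neighbourhood of the segment `[0,1]` in the plane: a closed
(tame) topological disc with `[0,1]` in its interior that does not meet the remaining
finite postcritical point `-1` of the quartic. -/
def IsRegularNhdUnitSegment (D : Set ℂ) : Prop :=
  (∃ Φ : ℂ ≃ₜ ℂ, D = Φ '' Metric.closedBall (0 : ℂ) 1) ∧
    segment ℝ (0 : ℂ) 1 ⊆ interior D ∧ (-1 : ℂ) ∉ D

/-- The boundary of a subset of the plane, as a subset of the sphere. -/
def boundaryCurve (D : Set ℂ) : Set P1 := (fun z : ℂ => (z : P1)) '' frontier D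

/-! ### Thurston's linear map -/

/-- `c` parametrizes the simple closed curve `γ` in `ℙ¹ - P`. -/
def Parametrizes {P : Set P1} (c : C(Circle, (Pᶜ : Set P1))) (γ : Set P1) : Prop :=
  Function.Injective c ∧ range (fun t => (c t : P1)) = γ

/-- Free homotopy in `ℙ¹ - P` of unoriented simple closed curves. -/
def FreelyHomotopic (P : Set P1) (γ δ : Set P1) : Prop :=
  ∃ c d : C(Circle, (Pᶜ : Set P1)), Parametrizes c γ ∧ Parametrizes d δ ∧ c.Homotopic d

/-- The simple closed curves `γ` in `ℙ¹ - P` such that each component of `ℙ¹ - γ` contains at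
least two points of `P`. The simple closed curves in the sphere are the images of a round circle
under homeomorphisms of the sphere (Schoenflies). -/
def IsEssentialCurve (P : Set P1) (γ : Set P1) : Prop :=
  (∃ Φ : P1 ≃ₜ P1, γ = Φ '' ((fun z : ℂ => (z : P1)) '' Metric.sphere (0 : ℂ) 1)) ∧
    Disjoint γ P ∧ ∀ x ∉ γ, 2 ≤ (connectedComponentIn γᶜ x ∩ P).encard

theorem IsEssentialCurve.freelyHomotopic_refl {P γ : Set P1} (h : IsEssentialCurve P γ) :
    FreelyHomotopic P γ γ := by
  obtain ⟨⟨Φ, rfl⟩, hd, -⟩ := h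
  have hm : ∀ t : Circle, Φ ((t : ℂ) : P1) ∈ Pᶜ := fun t ht =>
    hd.le_bot ⟨⟨_, ⟨(t : ℂ), by simp [Circle.norm_coe], rfl⟩, rfl⟩, ht⟩
  let c : C(Circle, (Pᶜ : Set P1)) := ⟨fun t => ⟨Φ ((t : ℂ) : P1), hm t⟩,
    (Φ.continuous.comp (OnePoint.continuous_coe.comp continuous_subtype_val)).subtype_mk _⟩
  have hc : Parametrizes c (Φ '' ((fun z : ℂ => (z : P1)) '' Metric.sphere (0 : ℂ) 1)) := by
    refine ⟨fun s t hst => ?_, ?_⟩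
    · have := Φ.injective (congrArg Subtype.val hst)
      exact Subtype.ext (OnePoint.coe_injective this)
    · ext x
      constructor
      · rintro ⟨t, rfl⟩
        exact ⟨_, ⟨(t : ℂ), by simp [Circle.norm_coe], rfl⟩, rfl⟩
      · rintro ⟨_, ⟨z, hz, rfl⟩, rfl⟩
        exact ⟨⟨z, by simpa [Submonoid.unitSphere] using hz⟩, rfl⟩
  exact ⟨c, c, hc, hc, ContinuousMap.Homotopic.refl c⟩

theorem FreelyHomotopic.symm {P γ δ : Set P1} (h : FreelyHomotopic P γ δ) :
    FreelyHomotopic P δ γ := by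
  obtain ⟨c, d, hc, hd, H⟩ := h
  exact ⟨d, c, hd, hc, H.symm⟩

theorem FreelyHomotopic.trans {P γ δ ε : Set P1} (h : FreelyHomotopic P γ δ)
    (h' : FreelyHomotopic P δ ε) : FreelyHomotopic P γ ε := by
  obtain ⟨c, d, hc, hd, H⟩ := h
  obtain ⟨d', e, hd', he, H'⟩ := h'
  -- reparametrize `c` by the homeomorphism `ρ = d⁻¹ ∘ d'` of the circle
  have hr : range d = range d' := by
    have := hd.2.trans hd'.2.symm
    apply Subtype.val_injective.image_injective
    rw [← range_comp, ← range_comp]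
    exact this
  have emb : IsEmbedding d := (d.continuous.isClosedEmbedding hd.1).isEmbedding
  choose ρ hρ using fun t : Circle => (hr ▸ mem_range_self t : d' t ∈ range d)
  have hρc : Continuous ρ := by
    rw [emb.continuous_iff]
    exact d'.continuous.congr fun t => (hρ t).symm
  have hρi : Function.Injective ρ := fun s t hst => hd'.1 (by rw [← hρ s, ← hρ t, hst])
  have hρs : Function.Surjective ρ := fun s => by
    obtain ⟨t, ht⟩ := (hr ▸ mem_range_self s : d s ∈ range d')
    exact ⟨t, hd.1 (by rw [hρ, ht])⟩
  let r : C(Circle, Circle) := ⟨ρ, hρc⟩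
  have hd'r : d.comp r = d' := ContinuousMap.ext hρ
  refine ⟨c.comp r, e, ⟨hc.1.comp hρi, ?_⟩, he, ?_⟩
  · rw [← hc.2]
    exact hρs.range_comp (fun t => (c t : P1))
  · exact ((H.comp (ContinuousMap.Homotopic.refl r)).trans (hd'r ▸ .refl _)).trans H'

/-- Free homotopy as an equivalence relation on the essential curves. -/
def curveSetoid (P : Set P1) : Setoid {γ : Set P1 // IsEssentialCurve P γ} where
  r γ δ := FreelyHomotopic P γ δ
  iseqv := ⟨fun γ => γ.2.freelyHomotopic_refl, fun h => h.symm, fun h h' => h.trans h'⟩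

/-- The set `𝒮` of free homotopy classes of essential curves in `ℙ¹ - P`. -/
abbrev CurveClass (P : Set P1) : Type := Quotient (curveSetoid P)

/-- The components of `f⁻¹(γ)`. -/
def preimageComponents (f : P1 → P1) (γ : Set P1) : Set (Set P1) :=
  {δ | ∃ x ∈ f ⁻¹' γ, δ = connectedComponentIn (f ⁻¹' γ) x}

/-- The degree of the covering `f : δ → γ`: the number of points of `δ` over a point of `γ`
(it is the same for all points of `γ`). -/
def coveringDegree (f : P1 → P1) (δ γ : Set P1) : ℕ :=
  ⨆ y : γ, (δ ∩ f ⁻¹' {(y : P1)}).ncard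

/-- The coefficient `d_i` of `λ_f [γ]` at the class `[γ_i]`: the sum of `1 / deg (δ → γ)` over the
components `δ` of `f⁻¹(γ)` that are homotopic to `γ_i`. -/
def thurstonCoeff (f : P1 → P1) (P : Set P1) (a b : CurveClass P) : ℝ :=
  ∑ᶠ δ ∈ {δ | δ ∈ preimageComponents f a.out.1 ∧ FreelyHomotopic P δ b.out.1},
    (1 : ℝ) / coveringDegree f δ a.out.1

/-- Thurston's linear map `λ_f : ℝ[𝒮] → ℝ[𝒮]` with respect to the marked set `P`. -/
def thurstonLinearMap (f : P1 → P1) (P : Set P1) :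
    (CurveClass P →₀ ℝ) →ₗ[ℝ] (CurveClass P →₀ ℝ) :=
  Finsupp.linearCombination ℝ fun a => ∑ᶠ b, Finsupp.single b (thurstonCoeff f P a b)

end DehnTwistLift

end

open DehnTwistLift

/-! Write `f = g ∘ q` with `q z = z²`, `g w = 2i (w - κ)²` and `κ = (1 + i)/2`. The finite critical
orbits run `±√κ → 0 → -1 → 1 → 1`. Both halves of the theorem are winding arguments, expressed by
continuous logarithms.

No pure lift (`not_pure_lift`): the path `α = f([0,1])` goes from `-1` to `1` in `ℂ \ {0}`. A twist
`T` about a curve separating `{0, 1}` from `{-1, ∞}` changes the variation of `log` along `α` by an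
odd multiple of `2πi` (`exists_log_twist`), and an isotopy relative to `P_f` does not affect this
number, since it fixes `0`, `∞` and the ends of `α`. If `h₀ ∘ f = f ∘ k` with `k` pure, then `y =
k([0,1])` runs from `0` to `1`, and `h₀(α)/α` is the square of `(y² - κ)/(s² - κ)`. That quotient is
`1` at both ends, so its logarithm varies by a multiple of `2πi`, and its square by an even
multiple. The obstruction is thus a parity, coming from the outer square in `f`.

`λ_f = 0` (`not_freelyHomotopic_of_mem_preimageComponents`): the set of points among `0, 1, -1`
around which a loop winds is invariant under homotopy in the complement of `P_f`. For an essential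
curve it has exactly two elements. For a loop in `f⁻¹(γ)`, with `γ` essential, it never has exactly
two: if `γ` leaves `1` outside, then `1` and `-1`, both mapped to `1`, lie outside the loop; if `γ`
leaves `-1` outside, then `0` lies outside the loop, and the component of the preimage of the disc
bounded by `γ` cannot contain both `1` and `-1`, because `z ↦ z²` is unbranched over it
(`hasLogVariation_of_neg_one_mem_outer`); if `γ` leaves `0` outside, then `g` is unbranched over the
disc, and the loop winds around all, or at most one, of the three points
(`hasLogVariation_of_zero_mem_outer`). So every coefficient of `λ_f` is an empty sum. -/

/-! ### Continuous logarithms and their variation -/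

/-- The function `u` has a continuous logarithm whose values at `y₁` and `y₀` differ by `c`. -/
def HasLogVariation {Y : Type*} [TopologicalSpace Y] (y₀ y₁ : Y) (u : Y → ℂ) (c : ℂ) : Prop :=
  ∃ ℓ : Y → ℂ, Continuous ℓ ∧ (∀ y, Complex.exp (ℓ y) = u y) ∧ ℓ y₁ - ℓ y₀ = c

namespace HasLogVariation

variable {Y : Type*} [TopologicalSpace Y] {y₀ y₁ : Y} {u v : Y → ℂ} {c c' : ℂ}

theorem mul (hu : HasLogVariation y₀ y₁ u c) (hv : HasLogVariation y₀ y₁ v c') :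
    HasLogVariation y₀ y₁ (fun y => u y * v y) (c + c') := by
  obtain ⟨ℓ, hℓ, he, rfl⟩ := hu
  obtain ⟨m, hm, he', rfl⟩ := hv
  exact ⟨fun y => ℓ y + m y, hℓ.add hm, fun y => by rw [Complex.exp_add, he, he'], by ring⟩

theorem inv (hu : HasLogVariation y₀ y₁ u c) :
    HasLogVariation y₀ y₁ (fun y => (u y)⁻¹) (-c) := by
  obtain ⟨ℓ, hℓ, he, rfl⟩ := hu
  exact ⟨fun y => -ℓ y, hℓ.neg, fun y => by rw [Complex.exp_neg, he], by ring⟩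

theorem const {a : ℂ} (ha : a ≠ 0) : HasLogVariation y₀ y₁ (fun _ => a) 0 :=
  ⟨fun _ => Complex.log a, continuous_const, fun _ => Complex.exp_log ha, sub_self _⟩

theorem congr (hu : HasLogVariation y₀ y₁ u c) (h : ∀ y, u y = v y) :
    HasLogVariation y₀ y₁ v c := (funext h : u = v) ▸ hu

theorem of_mem_slitPlane (hu : Continuous u) (hs : ∀ y, u y ∈ Complex.slitPlane)
    (h : u y₁ = u y₀) : HasLogVariation y₀ y₁ u 0 :=
  ⟨fun y => Complex.log (u y), hu.clog hs,
    fun y => Complex.exp_log (Complex.slitPlane_ne_zero (hs y)), by simp only [h, sub_self]⟩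

end HasLogVariation

/-- A continuous logarithm of `1` on a connected space is constant. -/
theorem eq_of_continuous_of_forall_exp_eq_one {Y : Type*} [TopologicalSpace Y]
    [PreconnectedSpace Y] {m : Y → ℂ} (hm : Continuous m) (h : ∀ y, Complex.exp (m y) = 1)
    (y y' : Y) : m y = m y' := by
  choose n hn using fun y => Complex.exp_eq_one_iff.1 (h y)
  -- The values of `m` lie in `2πiℤ`, so `m` is a continuous integer-valued function up to scale.
  have hc : Continuous n := by
    have h1 : Continuous fun y => ((n y : ℤ) : ℝ) := by
      have : (fun y => ((n y : ℤ) : ℝ)) = fun y => (m y).im / (2 * π) := by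
        funext y
        rw [hn y]
        simp [Real.pi_ne_zero]
      rw [this]
      exact (Complex.continuous_im.comp hm).div_const _
    exact Int.isClosedEmbedding_coe_real.isEmbedding.continuous_iff.2 h1
  rw [hn y, hn y', PreconnectedSpace.constant inferInstance hc (x := y) (y := y')]

theorem HasLogVariation.unique {Y : Type*} [TopologicalSpace Y] [PreconnectedSpace Y]
    {y₀ y₁ : Y} {u : Y → ℂ} {c c' : ℂ} (h : HasLogVariation y₀ y₁ u c)
    (h' : HasLogVariation y₀ y₁ u c') : c = c' := by
  obtain ⟨ℓ, hℓ, he, rfl⟩ := h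
  obtain ⟨m, hm, he', rfl⟩ := h'
  have := eq_of_continuous_of_forall_exp_eq_one (m := fun y => ℓ y - m y) (hℓ.sub hm) (fun y => by
    rw [Complex.exp_sub, he, he', div_self (he' y ▸ Complex.exp_ne_zero _)]) y₀ y₁
  linear_combination -this

/-- The variation of the logarithm is constant in a connected family of nowhere vanishing functions
on a compact space, as long as the ratio of the end values is. -/
theorem HasLogVariation.of_family {X Y : Type*} [TopologicalSpace X] [PreconnectedSpace X]
    [TopologicalSpace Y] [CompactSpace Y] {y₀ y₁ : Y} {G : X → Y → ℂ} {c k : ℂ}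
    (hG : Continuous fun q : X × Y => G q.1 q.2) (h0 : ∀ x y, G x y ≠ 0)
    (hk : ∀ x, G x y₁ = k * G x y₀) (x₀ x₁ : X) (h : HasLogVariation y₀ y₁ (G x₀) c) :
    HasLogVariation y₀ y₁ (G x₁) c := by
  have hGx : ∀ x, Continuous (G x) := fun x => hG.comp (by fun_prop : Continuous fun y => (x, y))
  have key : ∀ x, ∀ᶠ x' in 𝓝 x, ∀ y, G x' y / G x y ∈ Complex.slitPlane := by
    -- The ratio is `1` at `x' = x`. It stays in the slit plane for `x'` near `x`, uniformly in `y`,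
    -- because `Y` is compact.
    intro x
    have h1 : ∀ y ∈ (univ : Set Y), ∀ᶠ q : X × Y in 𝓝 x ×ˢ 𝓝 y,
        G q.1 q.2 / G x q.2 ∈ Complex.slitPlane := by
      intro y _
      rw [← nhds_prod_eq]
      have hc : Continuous fun q : X × Y => G q.1 q.2 / G x q.2 :=
        hG.div ((hGx x).comp continuous_snd) (fun q => h0 _ _)
      refine hc.continuousAt.eventually (Complex.isOpen_slitPlane.mem_nhds ?_)
      simp [div_self (h0 x y)]
    have := isCompact_univ.eventually_forall_of_forall_eventually (x₀ := x)
      (P := fun x' y => G x' y / G x y ∈ Complex.slitPlane) (fun y hy => by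
        have := h1 y hy
        rwa [← nhds_prod_eq] at this)
    simpa using this
  have step : ∀ x x', (∀ y, G x' y / G x y ∈ Complex.slitPlane) →
      (HasLogVariation y₀ y₁ (G x) c ↔ HasLogVariation y₀ y₁ (G x') c) := by
    intro x x' hs
    -- The principal logarithm serves for the ratio. By `hk` the ratio takes the same value at `y₀`
    -- and `y₁`, so it contributes no variation.
    have hr : HasLogVariation y₀ y₁ (fun y => G x' y / G x y) 0 := by
      refine .of_mem_slitPlane ((hGx x').div (hGx x) (h0 x)) hs ?_
      have e0 := h0 x y₀
      have e1 := h0 x y₁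
      have : k ≠ 0 := fun hk0 => e1 (by rw [hk, hk0, zero_mul])
      rw [hk, hk]
      field_simp
    constructor
    · intro hx
      have := (hx.mul hr).congr (v := G x') (fun y => mul_div_cancel₀ _ (h0 x y))
      rwa [add_zero] at this
    · intro hx
      have := (hx.mul hr.inv).congr (v := G x) (fun y => by
        have e0 := h0 x y
        have e1 := h0 x' y
        field_simp)
      rwa [neg_zero, add_zero] at this
  have hclopen : IsClopen {x | HasLogVariation y₀ y₁ (G x) c} := by
    refine ⟨⟨isOpen_iff_mem_nhds.2 fun x hx => ?_⟩, isOpen_iff_mem_nhds.2 fun x hx => ?_⟩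
    · filter_upwards [key x] with x' h' hx'
      exact hx ((step x x' h').2 hx')
    · filter_upwards [key x] with x' h'
      exact (step x x' h').1 hx
  have : x₁ ∈ {x | HasLogVariation y₀ y₁ (G x) c} := by
    rw [hclopen.eq_univ ⟨x₀, h⟩]
    trivial
  exact this

/-- A nowhere vanishing continuous function on a simply connected space has a continuous
logarithm. -/
theorem exists_continuous_log {Y : Type*} [TopologicalSpace Y] [SimplyConnectedSpace Y]
    [LocallyPathConnectedSpace Y] {u : Y → ℂ} (hu : Continuous u) (h0 : ∀ y, u y ≠ 0) :
    ∃ ℓ : Y → ℂ, Continuous ℓ ∧ ∀ y, Complex.exp (ℓ y) = u y := by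
  obtain ⟨y₀⟩ : Nonempty Y := inferInstance
  obtain ⟨F, ⟨-, hF⟩, -⟩ := Complex.isCoveringMapOn_exp.existsUnique_continuousMap_lifts
    ⟨u, hu⟩ (a₀ := y₀) (Complex.exp_log (h0 y₀)) (fun y => h0 y)
  exact ⟨F, F.continuous, fun y => congrFun hF y⟩

/-- The function is extended by constants to the real line, which is simply connected. -/
theorem exists_continuous_log_unitInterval {u : unitInterval → ℂ} (hu : Continuous u)
    (h0 : ∀ y, u y ≠ 0) :
    ∃ ℓ : unitInterval → ℂ, Continuous ℓ ∧ ∀ y, Complex.exp (ℓ y) = u y := by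
  obtain ⟨ℓ, hℓ, he⟩ := exists_continuous_log (Y := ℝ)
    (u := fun t => u (projIcc 0 1 zero_le_one t)) (hu.comp continuous_projIcc) (fun t => h0 _)
  exact ⟨fun t => ℓ t, hℓ.comp continuous_subtype_val, fun t => by rw [he, projIcc_val]⟩

/-- The inclusion of the unit circle into the punctured plane has no continuous logarithm. -/
theorem not_hasLogVariation_circle :
    ¬ HasLogVariation (1 : Circle) 1 (fun t => (t : ℂ)) 0 := by
  rintro ⟨ℓ, hℓ, he, -⟩
  -- A logarithm would make `ℓ(e^{iθ}) - iθ` constant, although it drops by `2πi` from `θ = 0` to `θ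
  -- = 2π`.
  have := eq_of_continuous_of_forall_exp_eq_one
    (m := fun θ : ℝ => ℓ (Circle.exp θ) - θ * Complex.I) (by fun_prop) (fun θ => by
      rw [Complex.exp_sub, he]
      simp only [Circle.coe_exp]
      exact div_self (Complex.exp_ne_zero _)) 0 (2 * π)
  simp only [Complex.ofReal_zero, zero_mul, sub_zero, Circle.exp_zero, Circle.exp_two_pi] at this
  refine Complex.two_pi_I_ne_zero ?_
  push_cast at this
  linear_combination this

/-- With both base points equal to `1`, the predicate only says that a logarithm exists, that is,
that the winding number vanishes. Here `t - a = -a (1 - t/a)`, and `1 - t/a` stays in the right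
half-plane. -/
theorem hasLogVariation_circle_sub {a : ℂ} (ha : 1 < ‖a‖) :
    HasLogVariation (1 : Circle) 1 (fun t => (t : ℂ) - a) 0 := by
  have ha0 : a ≠ 0 := norm_pos_iff.1 (zero_lt_one.trans ha)
  have h1 : HasLogVariation (1 : Circle) 1 (fun t => 1 - (t : ℂ) / a) 0 := by
    refine .of_mem_slitPlane (by fun_prop) (fun t => ?_) rfl
    rw [sub_eq_add_neg]
    refine Complex.mem_slitPlane_of_norm_lt_one ?_
    rw [norm_neg, norm_div, Circle.norm_coe, div_lt_one (zero_lt_one.trans ha)]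
    exact ha
  have := (h1.mul (.const (neg_ne_zero.2 ha0))).congr (v := fun t : Circle => (t : ℂ) - a) fun t => by
    field_simp
    ring
  simpa using this

/-- The point `a` slides to `0` along a radius without meeting the circle. -/
theorem not_hasLogVariation_circle_sub {a : ℂ} (ha : ‖a‖ < 1) :
    ¬ HasLogVariation (1 : Circle) 1 (fun t => (t : ℂ) - a) 0 := by
  intro h
  refine not_hasLogVariation_circle ?_
  have := HasLogVariation.of_family (X := unitInterval) (Y := Circle)
    (G := fun s t => (t : ℂ) - (s : ℝ) * a) (y₀ := 1) (y₁ := 1) (k := 1) (c := 0) (by fun_prop)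
    (fun s t h0 => ?_) (fun s => by simp) 1 0 (h.congr fun t => by simp)
  · exact this.congr fun t => by simp
  · have : ‖(t : ℂ)‖ = ‖((s : ℝ) : ℂ) * a‖ := by rw [sub_eq_zero.1 h0]
    rw [Circle.norm_coe, norm_mul, Complex.norm_real, Real.norm_of_nonneg s.2.1] at this
    nlinarith [s.2.1, s.2.2, norm_nonneg a]

/-! ### Topology of the sphere -/

theorem coclosedCompact_complex : coclosedCompact ℂ = Bornology.cobounded ℂ := by
  rw [coclosedCompact_eq_cocompact, Metric.cobounded_eq_cocompact]

/-- The inversion `z ↦ 1/z` of the sphere. -/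
noncomputable def sphereInv (x : P1) : P1 :=
  x.elim ((0 : ℂ) : P1) fun z => if z = 0 then OnePoint.infty else ((z⁻¹ : ℂ) : P1)

theorem sphereInv_infty : sphereInv OnePoint.infty = ((0 : ℂ) : P1) := rfl

theorem sphereInv_zero : sphereInv ((0 : ℂ) : P1) = OnePoint.infty := if_pos rfl

theorem sphereInv_coe {z : ℂ} (hz : z ≠ 0) : sphereInv (z : P1) = ((z⁻¹ : ℂ) : P1) := if_neg hz

theorem sphereInv_sphereInv (x : P1) : sphereInv (sphereInv x) = x := by
  induction x using OnePoint.rec with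
  | infty => rw [sphereInv_infty, sphereInv_zero]
  | coe z =>
    by_cases hz : z = 0
    · rw [hz, sphereInv_zero, sphereInv_infty]
    · rw [sphereInv_coe hz, sphereInv_coe (inv_ne_zero hz), inv_inv]

theorem continuous_sphereInv : Continuous sphereInv := by
  rw [continuous_iff_continuousAt]
  intro x
  induction x using OnePoint.rec with
  | infty =>
    rw [OnePoint.continuousAt_infty', coclosedCompact_complex, sphereInv_infty]
    have h : Tendsto (fun z : ℂ => ((z⁻¹ : ℂ) : P1)) (Bornology.cobounded ℂ)
        (𝓝 ((0 : ℂ) : P1)) :=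
      (OnePoint.continuous_coe.tendsto 0).comp tendsto_inv₀_cobounded
    refine h.congr' ?_
    filter_upwards [Bornology.eventually_ne_cobounded (0 : ℂ)] with z hz
    exact (sphereInv_coe hz).symm
  | coe z =>
    rw [OnePoint.continuousAt_coe]
    by_cases hz : z = 0
    · subst hz
      rw [continuousAt_iff_punctured_nhds]
      have h : Tendsto (fun z : ℂ => ((z⁻¹ : ℂ) : P1)) (𝓝[≠] 0) (𝓝 OnePoint.infty) := by
        refine OnePoint.tendsto_coe_infty.comp ?_
        rw [coclosedCompact_complex]
        exact tendsto_inv₀_nhdsNE_zero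
      simp only [Function.comp_apply, sphereInv_zero]
      refine h.congr' ?_
      filter_upwards [self_mem_nhdsWithin] with z hz
      exact (sphereInv_coe hz).symm
    · have h : ContinuousAt (fun z : ℂ => ((z⁻¹ : ℂ) : P1)) z :=
        OnePoint.continuous_coe.continuousAt.comp (continuousAt_inv₀ hz)
      refine h.congr ?_
      filter_upwards [isOpen_ne.mem_nhds hz] with z hz
      exact (sphereInv_coe hz).symm

/-- The inversion as a homeomorphism of the sphere. -/
noncomputable def sphereInvHomeo : P1 ≃ₜ P1 where
  toFun := sphereInv
  invFun := sphereInv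
  left_inv := sphereInv_sphereInv
  right_inv := sphereInv_sphereInv
  continuous_toFun := continuous_sphereInv
  continuous_invFun := continuous_sphereInv

/-- Bases at finite points come from the plane, and the inversion carries the one at `0` to `∞`.
This is what allows components of open sets to be joined by paths. -/
instance : LocallyPathConnectedSpace P1 where
  path_connected_basis x := by
    have hcoe : ∀ z : ℂ, ∀ t ∈ 𝓝 (z : P1), ∃ s ∈ 𝓝 (z : P1), IsPathConnected s ∧ s ⊆ t := by
      intro z t ht
      rw [OnePoint.nhds_coe_eq, mem_map] at ht
      obtain ⟨s, ⟨hs, hp⟩, hst⟩ := (path_connected_basis z).mem_iff.1 ht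
      refine ⟨(fun z : ℂ => (z : P1)) '' s, ?_, hp.image OnePoint.continuous_coe, ?_⟩
      · rw [OnePoint.nhds_coe_eq]
        exact image_mem_map hs
      · rintro _ ⟨w, hw, rfl⟩
        exact hst hw
    rw [hasBasis_self]
    intro t ht
    induction x using OnePoint.rec with
    | infty =>
      have h0 : sphereInv ⁻¹' t ∈ 𝓝 ((0 : ℂ) : P1) :=
        continuous_sphereInv.continuousAt.preimage_mem_nhds (by rwa [sphereInv_zero])
      obtain ⟨s, hs, hp, hst⟩ := hcoe 0 _ h0
      refine ⟨sphereInv '' s, ?_, hp.image continuous_sphereInv, image_subset_iff.2 hst⟩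
      have := sphereInvHomeo.isOpenMap.image_mem_nhds hs
      exact sphereInv_zero ▸ this
    | coe z => exact hcoe z t ht

/-- A continuous map to the sphere that avoids `∞` is a continuous map to the plane. -/
theorem exists_continuous_coe_eq {Y : Type*} [TopologicalSpace Y] {u : Y → P1}
    (hu : Continuous u) (h : ∀ y, u y ≠ OnePoint.infty) :
    ∃ v : Y → ℂ, Continuous v ∧ ∀ y, (v y : P1) = u y := by
  choose v hv using fun y => OnePoint.ne_infty_iff_exists.1 (h y)
  refine ⟨v, ?_, hv⟩
  rw [OnePoint.isOpenEmbedding_coe.isInducing.continuous_iff]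
  exact hu.congr fun y => (hv y).symm

/-- The function `x ↦ 1/(x - a)` on the sphere, with value `0` at `∞`. -/
noncomputable def invSub (a : ℂ) (x : P1) : ℂ := x.elim 0 fun z => (z - a)⁻¹

theorem invSub_infty (a : ℂ) : invSub a OnePoint.infty = 0 := rfl

theorem invSub_coe (a z : ℂ) : invSub a (z : P1) = (z - a)⁻¹ := rfl

theorem continuousAt_invSub {a : ℂ} {x : P1} (hx : x ≠ (a : P1)) : ContinuousAt (invSub a) x := by
  induction x using OnePoint.rec with
  | infty =>
    rw [OnePoint.continuousAt_infty', coclosedCompact_complex, invSub_infty]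
    exact tendsto_inv₀_cobounded.comp (tendsto_sub_const_cobounded a)
  | coe z =>
    rw [OnePoint.continuousAt_coe]
    have : z - a ≠ 0 := sub_ne_zero.2 fun h => hx (by rw [h])
    exact (continuousAt_id.sub continuousAt_const).inv₀ this

/-! ### Winding numbers of planar loops and the components of their complements in the sphere -/

section Winding

variable {Y : Type*} [TopologicalSpace Y] {y₀ y₁ : Y} {c : Y → ℂ}

/-- The expression equals `(c y - z)/(c y₀ - z)`, a constant multiple of `c y - z`. In contrast to
`c y - z` it extends continuously to `z = ∞`, with value `1`. -/
theorem hasLogVariation_invSub_iff {z : ℂ} (hz : ∀ y, c y ≠ z) :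
    HasLogVariation y₀ y₁ (fun y => 1 - (c y - c y₀) * invSub (c y₀) z) 0 ↔
      HasLogVariation y₀ y₁ (fun y => c y - z) 0 := by
  have h1 : c y₀ - z ≠ 0 := sub_ne_zero.2 (hz y₀)
  have conv : ∀ y, (1 - (c y - c y₀) * invSub (c y₀) z) * (c y₀ - z) = c y - z := by
    intro y
    rw [invSub_coe, ← neg_sub (c y₀) z, inv_neg]
    field_simp
    ring
  constructor <;> intro h
  · simpa only [add_zero] using (h.mul (.const h1)).congr conv
  · have := (h.mul (HasLogVariation.const h1).inv).congr
      (v := fun y => 1 - (c y - c y₀) * invSub (c y₀) z) fun y => by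
        rw [← conv y, mul_inv_cancel_right₀ h1]
    simpa only [neg_zero, add_zero] using this

variable [CompactSpace Y]

/-- The normalized functions form a nowhere vanishing family over the connected set `K`, even if `K`
contains `∞`, so `HasLogVariation.of_family` applies. -/
theorem hasLogVariation_invSub_of_mem {K : Set P1} (hK : IsPreconnected K) (hc : Continuous c)
    (h : c y₁ = c y₀) (hcK : ∀ y, (c y : P1) ∉ K) {x x' : P1} (hx : x ∈ K) (hx' : x' ∈ K)
    (hl : HasLogVariation y₀ y₁ (fun y => 1 - (c y - c y₀) * invSub (c y₀) x) 0) :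
    HasLogVariation y₀ y₁ (fun y => 1 - (c y - c y₀) * invSub (c y₀) x') 0 := by
  have hKs : PreconnectedSpace K := Subtype.preconnectedSpace hK
  refine HasLogVariation.of_family (X := K) (k := 1)
    (G := fun x y => 1 - (c y - c y₀) * invSub (c y₀) x) ?_ ?_ ?_ ⟨x, hx⟩ ⟨x', hx'⟩ hl
  · have : Continuous fun x : K => invSub (c y₀) x :=
      continuous_iff_continuousAt.2 fun x => (continuousAt_invSub fun h => hcK y₀ (h ▸ x.2)).comp
        continuous_subtype_val.continuousAt
    exact continuous_const.sub (((hc.comp continuous_snd).sub continuous_const).mul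
      (this.comp continuous_fst))
  · rintro ⟨x, hx⟩ y h0
    induction x using OnePoint.rec with
    | infty => simp [invSub_infty] at h0
    | coe z =>
      have h1 : z - c y₀ ≠ 0 := sub_ne_zero.2 fun h => hcK y₀ (h ▸ hx)
      simp only [invSub_coe] at h0
      field_simp at h0
      exact hcK y ((by linear_combination -h0 : c y = z) ▸ hx)
  · intro x
    simp [h]

/-- Whether a loop winds around a point or not depends only on the component of its complement that
contains the point. -/
theorem hasLogVariation_sub_of_mem {K : Set P1} (hK : IsPreconnected K) (hc : Continuous c)
    (h : c y₁ = c y₀) (hcK : ∀ y, (c y : P1) ∉ K) {p q : ℂ} (hp : (p : P1) ∈ K)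
    (hq : (q : P1) ∈ K) (hl : HasLogVariation y₀ y₁ (fun y => c y - p) 0) :
    HasLogVariation y₀ y₁ (fun y => c y - q) 0 := by
  rw [← hasLogVariation_invSub_iff fun y (e : c y = p) => hcK y (e ▸ hp)] at hl
  rw [← hasLogVariation_invSub_iff fun y (e : c y = q) => hcK y (e ▸ hq)]
  exact hasLogVariation_invSub_of_mem hK hc h hcK hp hq hl

/-- A loop does not wind around the points that are joined to `∞` in its complement. -/
theorem hasLogVariation_sub_of_infty_mem {K : Set P1} (hK : IsPreconnected K) (hc : Continuous c)
    (h : c y₁ = c y₀) (hcK : ∀ y, (c y : P1) ∉ K) (hi : OnePoint.infty ∈ K) {q : ℂ}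
    (hq : (q : P1) ∈ K) : HasLogVariation y₀ y₁ (fun y => c y - q) 0 := by
  rw [← hasLogVariation_invSub_iff fun y (e : c y = q) => hcK y (e ▸ hq)]
  refine hasLogVariation_invSub_of_mem hK hc h hcK hi hq ?_
  exact (HasLogVariation.const one_ne_zero).congr fun y => by simp [invSub_infty]

end Winding

/-! ### Preimages of connected sets -/

/-- A component of the preimage of a connected open set under an open map of a compact space maps
onto that set. -/
theorem image_connectedComponentIn_preimage {X Z : Type*} [TopologicalSpace X] [CompactSpace X]
    [LocallyConnectedSpace X] [TopologicalSpace Z] [T2Space Z] {F : X → Z} (hF : Continuous F)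
    (ho : IsOpenMap F) {V : Set Z} (hV : IsOpen V) (hVc : IsPreconnected V) {x : X}
    (hx : F x ∈ V) : V ⊆ F '' connectedComponentIn (F ⁻¹' V) x := by
  set W := connectedComponentIn (F ⁻¹' V) x with hW
  have hWV : W ⊆ F ⁻¹' V := connectedComponentIn_subset _ _
  have hxW : x ∈ W := mem_connectedComponentIn hx
  have hWo : IsOpen W := (hV.preimage hF).connectedComponentIn
  -- Components are relatively closed. Hence inside `V` the open set `F '' W` and the compact set `F
  -- '' closure W` coincide, and this set is clopen in `V`.
  have hcl : closure W ∩ F ⁻¹' V ⊆ W := by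
    have h1 : IsPreconnected (closure W ∩ F ⁻¹' V) :=
      isPreconnected_connectedComponentIn.subset_closure
        (subset_inter subset_closure hWV) inter_subset_left
    exact h1.subset_connectedComponentIn ⟨subset_closure hxW, hx⟩ inter_subset_right
  have hk : IsClosed (F '' closure W) := (isClosed_closure.isCompact.image hF).isClosed
  have hsub : V ∩ F '' closure W ⊆ F '' W := by
    rintro _ ⟨hy, w, hw, rfl⟩
    exact ⟨w, hcl ⟨hw, hy⟩, rfl⟩
  refine hVc.subset_left_of_subset_union (ho _ hWo) hk.isOpen_compl ?_ ?_ ⟨F x, hx, x, hxW, rfl⟩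
  · exact disjoint_compl_right.mono_left (image_mono subset_closure)
  · intro y hy
    by_cases h : y ∈ F '' closure W
    · exact Or.inl (hsub ⟨hy, h⟩)
    · exact Or.inr h

/-- If an open map of a compact space takes a value in a connected open set only once, then the
preimage of that set is connected. -/
theorem isPreconnected_preimage_of_unique {X Z : Type*} [TopologicalSpace X] [CompactSpace X]
    [LocallyConnectedSpace X] [TopologicalSpace Z] [T2Space Z] {F : X → Z} (hF : Continuous F)
    (ho : IsOpenMap F) {V : Set Z} (hV : IsOpen V) (hVc : IsPreconnected V) {x₀ : X}
    (hx₀ : F x₀ ∈ V) (h : ∀ x, F x = F x₀ → x = x₀) : IsPreconnected (F ⁻¹' V) := by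
  -- Each component maps onto `V`, so it contains a point of the fibre over `F x₀`, which is `x₀`
  -- alone.
  have : F ⁻¹' V ⊆ connectedComponentIn (F ⁻¹' V) x₀ := by
    intro x hx
    obtain ⟨w, hw, hwx⟩ := image_connectedComponentIn_preimage hF ho hV hVc hx hx₀
    rw [h w hwx] at hw
    rw [← connectedComponentIn_eq hw]
    exact mem_connectedComponentIn hx
  rw [this.antisymm (connectedComponentIn_subset _ _)]
  exact isPreconnected_connectedComponentIn

/-! ### Quadratic maps -/

/-- The quadratic polynomial `b (z - k)²` as a map of the sphere. -/
noncomputable def quadratic (b k : ℂ) : P1 → P1 := OnePoint.map fun z : ℂ => b * (z - k) ^ 2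

theorem quadratic_coe (b k z : ℂ) : quadratic b k (z : P1) = ((b * (z - k) ^ 2 : ℂ) : P1) := rfl

theorem quadratic_infty (b k : ℂ) : quadratic b k OnePoint.infty = OnePoint.infty := rfl

theorem quadratic_eq_infty {b k : ℂ} {x : P1} (h : quadratic b k x = OnePoint.infty) :
    x = OnePoint.infty := by
  induction x using OnePoint.rec with
  | infty => rfl
  | coe z => exact absurd h (OnePoint.coe_ne_infty _)

theorem tendsto_quadratic {b : ℂ} (hb : b ≠ 0) (k : ℂ) :
    Tendsto (fun z : ℂ => b * (z - k) ^ 2) (Bornology.cobounded ℂ) (Bornology.cobounded ℂ) :=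
  (Filter.tendsto_mul_left_cobounded hb).comp
    ((tendsto_pow_cobounded_cobounded two_ne_zero).comp (tendsto_sub_const_cobounded k))

theorem continuous_quadratic {b : ℂ} (hb : b ≠ 0) (k : ℂ) : Continuous (quadratic b k) := by
  refine OnePoint.continuous_map (by fun_prop) ?_
  rw [coclosedCompact_complex]
  exact tendsto_quadratic hb k

theorem isOpenMap_quadratic_complex {b : ℂ} (hb : b ≠ 0) (k : ℂ) :
    IsOpenMap fun z : ℂ => b * (z - k) ^ 2 := by
  have han : AnalyticOnNhd ℂ (fun z : ℂ => b * (z - k) ^ 2) univ :=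
    (by fun_prop : Differentiable ℂ fun z : ℂ => b * (z - k) ^ 2).differentiableOn.analyticOnNhd
      isOpen_univ
  rcases han.is_constant_or_isOpen isPreconnected_univ with ⟨w, hw⟩ | h
  · have h0 := hw k trivial
    have h1 := hw (k + 1) trivial
    simp at h0 h1
    exact absurd (h1.trans h0.symm) hb
  · exact fun s hs => h s (subset_univ s) hs

theorem isOpenMap_quadratic {b : ℂ} (hb : b ≠ 0) (k : ℂ) : IsOpenMap (quadratic b k) := by
  rw [isOpenMap_iff_nhds_le]
  intro x
  induction x using OnePoint.rec with
  | infty =>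
    intro t ht
    rw [mem_map] at ht
    obtain ⟨s, hst, hs, hi⟩ := mem_nhds_iff.1 ht
    -- Only `∞` maps to `∞`, so the compact image of `sᶜ` misses `∞`. By surjectivity, the
    -- complement of this image lies in the image of `s`.
    have hk : IsClosed (quadratic b k '' sᶜ) :=
      (hs.isClosed_compl.isCompact.image (continuous_quadratic hb k)).isClosed
    refine mem_of_superset (hk.isOpen_compl.mem_nhds ?_) ?_
    · rintro ⟨x, hx, he⟩
      exact hx (quadratic_eq_infty he ▸ hi)
    · intro y hy
      have hsurj : ∃ x, quadratic b k x = y := by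
        induction y using OnePoint.rec with
        | infty => exact ⟨_, quadratic_infty b k⟩
        | coe w =>
          obtain ⟨r, hr⟩ := IsAlgClosed.exists_pow_nat_eq (w / b) two_pos
          refine ⟨((k + r : ℂ) : P1), ?_⟩
          rw [quadratic_coe]
          congr 1
          rw [add_sub_cancel_left, hr]
          field_simp
      obtain ⟨x, rfl⟩ := hsurj
      by_contra hnt
      exact hy ⟨x, fun hxs => hnt (hst hxs), rfl⟩
  | coe z =>
    rw [quadratic_coe, OnePoint.nhds_coe_eq, OnePoint.nhds_coe_eq, map_map]
    have h1 : quadratic b k ∘ ((↑) : ℂ → P1) = ((↑) : ℂ → P1) ∘ fun z : ℂ => b * (z - k) ^ 2 := rfl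
    rw [h1, ← map_map]
    exact map_mono ((isOpenMap_quadratic_complex hb k).nhds_le z)

/-- The two points of a fibre of a quadratic map are not joined in the preimage of a set that leaves
both critical values in one connected set. -/
theorem not_joinedIn_quadratic {b k a : ℂ} (hb : b ≠ 0) {L : Set P1} (hL : IsPreconnected L)
    (h0 : ((0 : ℂ) : P1) ∈ L) (hi : OnePoint.infty ∈ L) :
    ¬ JoinedIn {x | quadratic b k x ∉ L} ((k + a : ℂ) : P1) ((k - a : ℂ) : P1) := by
  rintro ⟨γ, hγ⟩
  obtain ⟨z, hz, hzγ⟩ := exists_continuous_coe_eq γ.continuous (fun t ht => by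
    have := hγ t
    rw [ht] at this
    exact this hi)
  have hz0 : z 0 = k + a := OnePoint.coe_injective ((hzγ 0).trans γ.source)
  have hz1 : z 1 = k - a := OnePoint.coe_injective ((hzγ 1).trans γ.target)
  have hav : ∀ t, ((b * (z t - k) ^ 2 : ℂ) : P1) ∉ L := fun t => by
    rw [← quadratic_coe, hzγ]
    exact hγ t
  -- The image path is a loop, since `k + a` and `k - a` have the same image. It avoids `L`, which
  -- connects `0` with `∞`, so it does not wind around `0`.
  have hl := hasLogVariation_sub_of_infty_mem (y₀ := (0 : unitInterval)) (y₁ := 1)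
    (c := fun t => b * (z t - k) ^ 2) hL (by fun_prop) (by rw [hz0, hz1]; ring) hav hi h0
  have hne : ∀ t, z t - k ≠ 0 := fun t h => hav t (by simpa [h] using h0)
  obtain ⟨m, hm, hme⟩ := exists_continuous_log_unitInterval (by fun_prop : Continuous fun t => z t - k) hne
  have hm' : HasLogVariation (0 : unitInterval) 1 (fun t => z t - k) (m 1 - m 0) :=
    ⟨m, hm, hme, rfl⟩
  have h2 := (((HasLogVariation.const hb).mul (hm'.mul hm')).congr (fun t => by ring)).unique hl
  -- Halving the variation shows that `z - k` returns to its initial value, whereas its end values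
  -- are `a` and `-a`. This forces `a = 0`, and then the path starts at the critical point, whose
  -- image `0` lies in `L`.
  have h3 : m 1 = m 0 := by linear_combination h2 / 2
  have h4 : z 1 - k = z 0 - k := by rw [← hme, ← hme, h3]
  refine hne 0 ?_
  rw [hz0] at h4 ⊢
  rw [hz1] at h4
  linear_combination -h4 / 2

/-! ### The quartic and its postcritical set -/

/-- The critical value `(1 + i)/2` of the outer quadratic factor of the quartic. -/
noncomputable def kappa : ℂ := (1 + Complex.I) / 2

theorem two_mul_I_ne_zero : (2 * Complex.I : ℂ) ≠ 0 := mul_ne_zero two_ne_zero Complex.I_ne_zero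

theorem kappa_im : kappa.im = 1 / 2 := by simp [kappa]

theorem kappa_sq : 2 * kappa ^ 2 = Complex.I := by
  unfold kappa
  linear_combination Complex.I_sq / 2

theorem quartic_eq (x : P1) : quartic x = quadratic (2 * Complex.I) kappa (quadratic 1 0 x) := by
  induction x using OnePoint.rec with
  | infty => rfl
  | coe z => simp [quartic, quadratic_coe, kappa]

theorem quartic_coe (z : ℂ) :
    quartic (z : P1) = ((2 * Complex.I * (z ^ 2 - kappa) ^ 2 : ℂ) : P1) := rfl

theorem quartic_infty : quartic OnePoint.infty = OnePoint.infty := rfl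

theorem quartic_zero : quartic ((0 : ℂ) : P1) = ((-1 : ℂ) : P1) := by
  rw [quartic_coe]
  congr 1
  linear_combination Complex.I * kappa_sq + Complex.I_sq

theorem quartic_one : quartic ((1 : ℂ) : P1) = ((1 : ℂ) : P1) := by
  rw [quartic_coe]
  congr 1
  unfold kappa
  linear_combination (Complex.I / 2 - 1) * Complex.I_sq

theorem quartic_neg_one : quartic ((-1 : ℂ) : P1) = ((1 : ℂ) : P1) := by
  rw [← quartic_one, quartic_coe, quartic_coe, neg_one_sq, one_pow]

theorem continuous_quartic : Continuous quartic := by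
  rw [funext quartic_eq]
  exact (continuous_quadratic two_mul_I_ne_zero _).comp (continuous_quadratic one_ne_zero _)

theorem isOpenMap_quartic : IsOpenMap quartic := by
  rw [funext quartic_eq]
  exact (isOpenMap_quadratic two_mul_I_ne_zero _).comp (isOpenMap_quadratic one_ne_zero _)

/-- The points `k + z` and `k - z` share an image. They are close to `k` for small `z` and close to
`∞` for large `z`. -/
theorem not_injOn_quadratic {b k : ℂ} {V : Set P1}
    (hV : V ∈ 𝓝 (k : P1) ∨ V ∈ 𝓝 (OnePoint.infty : P1)) :
    ∃ x ∈ V, ∃ y ∈ V, x ≠ y ∧ quadratic b k x = quadratic b k y := by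
  obtain ⟨z, hz, h1, h2⟩ : ∃ z : ℂ, z ≠ 0 ∧ ((k + z : ℂ) : P1) ∈ V ∧ ((k - z : ℂ) : P1) ∈ V := by
    rcases hV with hV | hV
    · rw [OnePoint.nhds_coe_eq, mem_map] at hV
      have h1 : ∀ᶠ z : ℂ in 𝓝[≠] 0, ((k + z : ℂ) : P1) ∈ V :=
        ((by fun_prop : Continuous fun z : ℂ => k + z).tendsto' 0 k (by simp)).mono_left
          nhdsWithin_le_nhds hV
      have h2 : ∀ᶠ z : ℂ in 𝓝[≠] 0, ((k - z : ℂ) : P1) ∈ V :=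
        ((by fun_prop : Continuous fun z : ℂ => k - z).tendsto' 0 k (by simp)).mono_left
          nhdsWithin_le_nhds hV
      exact ((eventually_mem_nhdsWithin.and (h1.and h2))).exists
    · have hV' : ∀ᶠ z : ℂ in Bornology.cobounded ℂ, (z : P1) ∈ V := by
        rw [← coclosedCompact_complex]
        exact OnePoint.tendsto_coe_infty hV
      have h1 := (tendsto_const_add_cobounded k).eventually hV'
      have h2 := (tendsto_const_sub_cobounded k).eventually hV'
      exact ((Bornology.eventually_ne_cobounded (0 : ℂ)).and (h1.and h2)).exists
  refine ⟨_, h1, _, h2, fun h => hz ?_, ?_⟩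
  · have := OnePoint.coe_injective h
    linear_combination this / 2
  · rw [quadratic_coe, quadratic_coe]
    congr 1
    ring

/-- Near `±√κ` the inner square is open, so it carries neighbourhoods to neighbourhoods of the
critical point `κ` of the outer factor. At `0` and `∞` the inner square itself fails to be
injective. -/
theorem mem_criticalPoints_of_quadratic {x : P1}
    (h : quadratic 1 0 x = (kappa : P1) ∨ x = ((0 : ℂ) : P1) ∨ x = OnePoint.infty) :
    x ∈ criticalPoints quartic := by
  rintro ⟨U, hU, hinj⟩
  rcases h with h | h
  · have hV : quadratic 1 0 '' U ∈ 𝓝 (kappa : P1) := by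
      rw [← h]
      exact (isOpenMap_quadratic one_ne_zero 0).image_mem_nhds hU
    obtain ⟨_, ⟨y, hy, rfl⟩, _, ⟨z, hz, rfl⟩, hne, he⟩ := not_injOn_quadratic (Or.inl hV)
    rw [← quartic_eq, ← quartic_eq] at he
    exact hne (by rw [hinj hy hz he])
  · obtain ⟨y, hy, z, hz, hne, he⟩ := not_injOn_quadratic (b := 1) (k := 0) (V := U)
      (by rcases h with rfl | rfl <;> simp [hU])
    exact hne (hinj hy hz (by rw [quartic_eq, quartic_eq, he]))

theorem notMem_criticalPoints {z : ℂ} (h0 : z ≠ 0) (hk : z ^ 2 ≠ kappa) :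
    (z : P1) ∉ criticalPoints quartic := by
  intro h
  refine h ?_
  have hd : HasStrictDerivAt (fun z : ℂ => 2 * Complex.I * (z ^ 2 - kappa) ^ 2)
      (2 * Complex.I * (2 * (z ^ 2 - kappa) * (2 * z))) z := by
    have h1 : HasStrictDerivAt (fun z : ℂ => z ^ 2 - kappa) (2 * z) z := by
      have : HasStrictDerivAt (fun z : ℂ => z ^ 2) (2 * z) z := by
        simpa using hasStrictDerivAt_pow 2 z
      exact this.sub_const kappa
    have h2 : HasStrictDerivAt (fun z : ℂ => (z ^ 2 - kappa) ^ 2)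
        (2 * (z ^ 2 - kappa) * (2 * z)) z := by
      have := h1.fun_pow 2
      simpa using this
    exact h2.const_mul _
  have hne : 2 * Complex.I * (2 * (z ^ 2 - kappa) * (2 * z)) ≠ 0 :=
    mul_ne_zero two_mul_I_ne_zero (mul_ne_zero (mul_ne_zero two_ne_zero (sub_ne_zero.2 hk))
      (mul_ne_zero two_ne_zero h0))
  let e := (hd.hasStrictFDerivAt_equiv hne).toOpenPartialHomeomorph _
  refine ⟨(fun z : ℂ => (z : P1)) '' e.source, ?_, ?_⟩
  · rw [OnePoint.nhds_coe_eq]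
    exact image_mem_map (e.open_source.mem_nhds
      (hd.hasStrictFDerivAt_equiv hne).mem_toOpenPartialHomeomorph_source)
  · rintro _ ⟨x, hx, rfl⟩ _ ⟨y, hy, rfl⟩ hxy
    have := e.injOn hx hy (OnePoint.coe_injective hxy)
    rw [this]

/-- The critical points are `0`, `±√κ` and `∞`, with orbits `√κ → 0 → -1 → 1 → 1` and `∞ → ∞`. -/
theorem Pf_eq : Pf = {((0 : ℂ) : P1), ((1 : ℂ) : P1), ((-1 : ℂ) : P1), OnePoint.infty} := by
  apply Subset.antisymm
  · refine iUnion_subset fun n => ?_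
    rintro _ ⟨x, hx, rfl⟩
    induction n with
    | zero =>
      induction x using OnePoint.rec with
      | infty => simp [quartic_infty]
      | coe z =>
        by_cases h0 : z = 0
        · simp [h0, quartic_zero]
        · by_cases hk : z ^ 2 = kappa
          · simp [quartic_coe, hk]
          · exact absurd hx (notMem_criticalPoints h0 hk)
    | succ n ih =>
      rw [Function.iterate_succ_apply']
      rcases ih with h | h | h | h <;> rw [h]
      · simp [quartic_zero]
      · simp [quartic_one]
      · simp [quartic_neg_one]
      · simp [quartic_infty]
  · have hz : ((0 : ℂ) : P1) ∈ criticalPoints quartic :=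
      mem_criticalPoints_of_quadratic (Or.inr (Or.inl rfl))
    rintro _ (rfl | rfl | rfl | rfl)
    -- The index `n` stands for the iterate `n + 1`: `0 = f(√κ)`, `1 = f²(0)`, `-1 = f(0)` and `∞ =
    -- f(∞)`.
    · obtain ⟨r, hr⟩ := IsAlgClosed.exists_pow_nat_eq kappa two_pos
      refine mem_iUnion.2 ⟨0, (r : P1), mem_criticalPoints_of_quadratic (Or.inl ?_), ?_⟩
      · simp [quadratic_coe, hr]
      · simp [quartic_coe, hr]
    · exact mem_iUnion.2 ⟨1, _, hz, by simp [quartic_zero, quartic_neg_one]⟩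
    · exact mem_iUnion.2 ⟨0, _, hz, by simp [quartic_zero]⟩
    · exact mem_iUnion.2 ⟨0, _, mem_criticalPoints_of_quadratic (Or.inr (Or.inr rfl)),
        by simp [quartic_infty]⟩

/-! ### The two sides of a simple closed curve -/

/-- The image of the round disc of radius `r` under a homeomorphism of the sphere. -/
def innerDomain (Φ : P1 ≃ₜ P1) (r : ℝ) : Set P1 :=
  Φ '' ((fun z : ℂ => (z : P1)) '' Metric.ball (0 : ℂ) r)

/-- The image of the exterior of the round disc of radius `r` under a homeomorphism of the
sphere. -/
def outerDomain (Φ : P1 ≃ₜ P1) (r : ℝ) : Set P1 :=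
  Φ '' ((fun z : ℂ => (z : P1)) '' Metric.closedBall (0 : ℂ) r)ᶜ

/-- The image of the unit circle under a homeomorphism of the sphere. -/
def jordanCurve (Φ : P1 ≃ₜ P1) : Set P1 :=
  Φ '' ((fun z : ℂ => (z : P1)) '' Metric.sphere (0 : ℂ) 1)

section Domains

variable {Φ : P1 ≃ₜ P1} {r r' : ℝ}

theorem coe_mem_innerDomain {z : ℂ} : Φ (z : P1) ∈ innerDomain Φ r ↔ ‖z‖ < r := by
  rw [innerDomain, Φ.injective.mem_set_image, OnePoint.coe_injective.mem_set_image]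
  simp

theorem coe_mem_outerDomain {z : ℂ} : Φ (z : P1) ∈ outerDomain Φ r ↔ r < ‖z‖ := by
  rw [outerDomain, Φ.injective.mem_set_image, mem_compl_iff,
    OnePoint.coe_injective.mem_set_image]
  simp

theorem coe_mem_jordanCurve {z : ℂ} : Φ (z : P1) ∈ jordanCurve Φ ↔ ‖z‖ = 1 := by
  rw [jordanCurve, Φ.injective.mem_set_image, OnePoint.coe_injective.mem_set_image]
  simp

theorem infty_notMem_innerDomain : Φ OnePoint.infty ∉ innerDomain Φ r := by
  rw [innerDomain, Φ.injective.mem_set_image]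
  simp

theorem infty_mem_outerDomain : Φ OnePoint.infty ∈ outerDomain Φ r := by
  rw [outerDomain, Φ.injective.mem_set_image]
  simp

theorem infty_notMem_jordanCurve : Φ OnePoint.infty ∉ jordanCurve Φ := by
  rw [jordanCurve, Φ.injective.mem_set_image]
  simp

theorem forall_sphere {p : P1 → Prop} (Φ : P1 ≃ₜ P1) (hi : p (Φ OnePoint.infty))
    (hc : ∀ z : ℂ, p (Φ z)) (x : P1) : p x := by
  obtain ⟨y, rfl⟩ := Φ.surjective x
  induction y using OnePoint.rec with
  | infty => exact hi
  | coe z => exact hc z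

theorem isOpen_innerDomain : IsOpen (innerDomain Φ r) :=
  Φ.isOpenMap _ (OnePoint.isOpen_image_coe.2 Metric.isOpen_ball)

theorem isOpen_outerDomain : IsOpen (outerDomain Φ r) :=
  Φ.isOpenMap _ (OnePoint.isOpen_compl_image_coe.2
    ⟨Metric.isClosed_closedBall, isCompact_closedBall _ _⟩)

theorem isPreconnected_innerDomain : IsPreconnected (innerDomain Φ r) :=
  (((convex_ball (0 : ℂ) r).isPreconnected).image _ OnePoint.continuous_coe.continuousOn).image _
    Φ.continuous.continuousOn

theorem sphereInvHomeo_trans_coe_inv {z : ℂ} (hz : z ≠ 0) :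
    (sphereInvHomeo.trans Φ) ((z⁻¹ : ℂ) : P1) = Φ z := by
  have h : sphereInv ((z⁻¹ : ℂ) : P1) = (z : P1) := by
    rw [sphereInv_coe (inv_ne_zero hz), inv_inv]
  exact congrArg Φ h

/-- Precomposing `Φ` with `z ↦ 1/z` exchanges the two sides, so facts about the exterior, such as
its connectedness, reduce to those about a round disc. -/
theorem outerDomain_eq (hr : 0 < r) :
    outerDomain Φ r = innerDomain (sphereInvHomeo.trans Φ) r⁻¹ := by
  ext x
  revert x
  refine forall_sphere Φ ?_ fun z => ?_
  · have : Φ OnePoint.infty = (sphereInvHomeo.trans Φ) ((0 : ℂ) : P1) :=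
      congrArg Φ sphereInv_zero.symm
    simp only [infty_mem_outerDomain, true_iff]
    rw [this, coe_mem_innerDomain]
    simpa using hr
  · rw [coe_mem_outerDomain]
    by_cases hz : z = 0
    · have : Φ (z : P1) = (sphereInvHomeo.trans Φ) OnePoint.infty := by rw [hz]; rfl
      rw [this]
      simp only [infty_notMem_innerDomain, iff_false, hz, norm_zero, not_lt]
      exact hr.le
    · rw [← sphereInvHomeo_trans_coe_inv hz, coe_mem_innerDomain, norm_inv, inv_lt_inv₀ (norm_pos_iff.2 hz) hr]

theorem isPreconnected_outerDomain (hr : 0 < r) : IsPreconnected (outerDomain Φ r) := by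
  rw [outerDomain_eq hr]
  exact isPreconnected_innerDomain

theorem disjoint_inner_outer (h : r ≤ r') : Disjoint (innerDomain Φ r) (outerDomain Φ r') := by
  rw [disjoint_left]
  refine forall_sphere Φ (fun h => absurd h infty_notMem_innerDomain) fun z hz => ?_
  rw [coe_mem_innerDomain] at hz
  rw [coe_mem_outerDomain]
  linarith

theorem innerDomain_mono (h : r ≤ r') : innerDomain Φ r ⊆ innerDomain Φ r' :=
  image_mono (image_mono (Metric.ball_subset_ball h))

theorem outerDomain_anti (h : r ≤ r') : outerDomain Φ r' ⊆ outerDomain Φ r :=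
  image_mono (compl_subset_compl.2 (image_mono (Metric.closedBall_subset_closedBall h)))

theorem inner_inter_outer_nonempty (h0 : 0 ≤ r) (h : r < r') :
    (innerDomain Φ r' ∩ outerDomain Φ r).Nonempty := by
  obtain ⟨m, h1, h2⟩ := exists_between h
  have hm : ‖(m : ℂ)‖ = m := by
    rw [Complex.norm_real, Real.norm_of_nonneg (h0.trans h1.le)]
  exact ⟨Φ ((m : ℂ) : P1), coe_mem_innerDomain.2 (hm.symm ▸ h2),
    coe_mem_outerDomain.2 (hm.symm ▸ h1)⟩

theorem jordanCurve_subset_innerDomain (h : 1 < r) : jordanCurve Φ ⊆ innerDomain Φ r := by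
  refine forall_sphere Φ (fun h => absurd h infty_notMem_jordanCurve) fun z hz => ?_
  rw [coe_mem_jordanCurve] at hz
  rw [coe_mem_innerDomain]
  linarith

theorem disjoint_jordanCurve_innerDomain : Disjoint (jordanCurve Φ) (innerDomain Φ 1) := by
  rw [disjoint_left]
  refine forall_sphere Φ (fun h => absurd h infty_notMem_jordanCurve) fun z hz => ?_
  rw [coe_mem_jordanCurve] at hz
  rw [coe_mem_innerDomain]
  linarith

theorem disjoint_jordanCurve_outerDomain : Disjoint (jordanCurve Φ) (outerDomain Φ 1) := by
  rw [disjoint_left]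
  refine forall_sphere Φ (fun h => absurd h infty_notMem_jordanCurve) fun z hz => ?_
  rw [coe_mem_jordanCurve] at hz
  rw [coe_mem_outerDomain]
  linarith

theorem mem_inner_or_outer : ∀ x ∉ jordanCurve Φ,
    x ∈ innerDomain Φ 1 ∨ x ∈ outerDomain Φ 1 := by
  refine forall_sphere Φ (fun _ => Or.inr infty_mem_outerDomain) fun z hz => ?_
  rw [coe_mem_jordanCurve] at hz
  rw [coe_mem_innerDomain, coe_mem_outerDomain]
  exact lt_or_gt_of_ne hz

/-- This leaves a collar between the curve and the given point, the room needed to glue preimages of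
the two sides along an overlap. -/
theorem exists_mem_outerDomain : ∀ x ∈ outerDomain Φ r, ∃ r' > r, x ∈ outerDomain Φ r' := by
  refine forall_sphere Φ (fun _ => ⟨r + 1, by linarith, infty_mem_outerDomain⟩) fun z hz => ?_
  rw [coe_mem_outerDomain] at hz
  obtain ⟨m, h1, h2⟩ := exists_between hz
  exact ⟨m, h1, coe_mem_outerDomain.2 h2⟩

/-- Either `Φ` or its composite with the inversion will do. It is applied to `x = ∞`, so that
"inner" means the bounded side. -/
theorem exists_jordanCurve_eq (Φ : P1 ≃ₜ P1) {x : P1} (hx : x ∉ jordanCurve Φ) :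
    ∃ Ψ : P1 ≃ₜ P1, jordanCurve Φ = jordanCurve Ψ ∧ x ∈ outerDomain Ψ 1 := by
  rcases mem_inner_or_outer _ hx with h | h
  · refine ⟨sphereInvHomeo.trans Φ, ?_, ?_⟩
    · ext y
      revert y
      have key : ∀ y ∈ jordanCurve Φ, y ∈ jordanCurve (sphereInvHomeo.trans Φ) := by
        refine forall_sphere Φ (fun h => absurd h infty_notMem_jordanCurve) fun z hz => ?_
        rw [coe_mem_jordanCurve] at hz
        have hz0 : z ≠ 0 := fun h => by simp [h] at hz
        rw [← sphereInvHomeo_trans_coe_inv hz0, coe_mem_jordanCurve, norm_inv, hz, inv_one]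
      refine fun y => ⟨key y, ?_⟩
      revert y
      refine forall_sphere (sphereInvHomeo.trans Φ)
        (fun h => absurd h infty_notMem_jordanCurve) fun z hz => ?_
      rw [coe_mem_jordanCurve] at hz
      have hz0 : z ≠ 0 := fun h => by simp [h] at hz
      have : (sphereInvHomeo.trans Φ) (z : P1) = Φ ((z⁻¹ : ℂ) : P1) :=
        congrArg Φ (sphereInv_coe hz0)
      rw [this, coe_mem_jordanCurve, norm_inv, hz, inv_one]
    · have h2 : sphereInvHomeo.trans (sphereInvHomeo.trans Φ) = Φ :=
        Homeomorph.ext fun x => congrArg Φ (sphereInv_sphereInv x)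
      rwa [outerDomain_eq zero_lt_one, h2, inv_one]
  · exact ⟨Φ, rfl, h⟩

theorem connectedComponentIn_subset_inner {x : P1} (hx : x ∈ innerDomain Φ 1) :
    connectedComponentIn (jordanCurve Φ)ᶜ x ⊆ innerDomain Φ 1 :=
  isPreconnected_connectedComponentIn.subset_left_of_subset_union isOpen_innerDomain
    isOpen_outerDomain (disjoint_inner_outer le_rfl)
    (fun _ hy => mem_inner_or_outer _ (connectedComponentIn_subset _ _ hy))
    ⟨x, mem_connectedComponentIn (disjoint_right.1 disjoint_jordanCurve_innerDomain hx), hx⟩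

theorem connectedComponentIn_subset_outer {x : P1} (hx : x ∈ outerDomain Φ 1) :
    connectedComponentIn (jordanCurve Φ)ᶜ x ⊆ outerDomain Φ 1 :=
  isPreconnected_connectedComponentIn.subset_right_of_subset_union isOpen_innerDomain
    isOpen_outerDomain (disjoint_inner_outer le_rfl)
    (fun _ hy => mem_inner_or_outer _ (connectedComponentIn_subset _ _ hy))
    ⟨x, mem_connectedComponentIn (disjoint_right.1 disjoint_jordanCurve_outerDomain hx), hx⟩

end Domains

/-- An essential curve encloses exactly two of the points `0, 1, -1`. -/
theorem exists_domains_of_isEssentialCurve {γ : Set P1} (hγ : IsEssentialCurve Pf γ) :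
    ∃ (Φ : P1 ≃ₜ P1) (r : ℝ) (p q s : ℂ), 1 < r ∧ γ = jordanCurve Φ ∧
      OnePoint.infty ∈ outerDomain Φ r ∧ (p : P1) ∈ outerDomain Φ r ∧
      (q : P1) ∈ innerDomain Φ 1 ∧ (s : P1) ∈ innerDomain Φ 1 ∧
      ((p = 0 ∧ q = 1 ∧ s = -1) ∨ (p = 1 ∧ q = 0 ∧ s = -1) ∨ (p = -1 ∧ q = 0 ∧ s = 1)) := by
  obtain ⟨⟨Φ₀, hΦ₀⟩, hd, hcard⟩ := hγ
  have hP : ∀ x ∈ Pf, x ∉ γ := fun x hx hxγ => hd.le_bot ⟨hxγ, hx⟩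
  have hiP : OnePoint.infty ∈ Pf := by simp [Pf_eq]
  obtain ⟨Φ, hΦ, hi⟩ := exists_jordanCurve_eq Φ₀ (x := OnePoint.infty) (by
    have := hP _ hiP
    rwa [hΦ₀] at this)
  have hγ : γ = jordanCurve Φ := hΦ₀.trans hΦ
  subst hγ
  have hside : ∀ x ∈ Pf, x ∈ innerDomain Φ 1 ∨ x ∈ outerDomain Φ 1 := fun x hx =>
    mem_inner_or_outer _ (hP x hx)
  -- A side with at most one postcritical point contradicts essentiality.
  have hin : ∀ {a : P1}, innerDomain Φ 1 ∩ Pf ⊆ {a} → False := by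
    intro a ha
    have h0 : Φ ((0 : ℂ) : P1) ∈ innerDomain Φ 1 := by
      rw [coe_mem_innerDomain]
      simp
    have h1 := hcard _ (disjoint_right.1 disjoint_jordanCurve_innerDomain h0)
    have h2 := encard_le_encard ((inter_subset_inter_left Pf
      (connectedComponentIn_subset_inner h0)).trans ha)
    rw [encard_singleton] at h2
    exact absurd (h1.trans h2) (by norm_num)
  have hout : ∀ {a : P1}, outerDomain Φ 1 ∩ Pf ⊆ {a} → False := by
    intro a ha
    have h1 := hcard _ (disjoint_right.1 disjoint_jordanCurve_outerDomain hi)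
    have h2 := encard_le_encard ((inter_subset_inter_left Pf
      (connectedComponentIn_subset_outer hi)).trans ha)
    rw [encard_singleton] at h2
    exact absurd (h1.trans h2) (by norm_num)
  have hno : ∀ {x}, x ∈ innerDomain Φ 1 → x ∉ outerDomain Φ 1 := fun hx hx' =>
    (disjoint_inner_outer le_rfl).le_bot ⟨hx, hx'⟩
  suffices ∃ p q s : ℂ, (p : P1) ∈ outerDomain Φ 1 ∧
      (q : P1) ∈ innerDomain Φ 1 ∧ (s : P1) ∈ innerDomain Φ 1 ∧
      ((p = 0 ∧ q = 1 ∧ s = -1) ∨ (p = 1 ∧ q = 0 ∧ s = -1) ∨ (p = -1 ∧ q = 0 ∧ s = 1)) by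
    obtain ⟨p, q, s, hp, hq, hs, h⟩ := this
    obtain ⟨r, hr, hr'⟩ := exists_mem_outerDomain _ hp
    obtain ⟨r₂, hr₂, hr₂'⟩ := exists_mem_outerDomain _ hi
    exact ⟨Φ, min r r₂, p, q, s, lt_min hr hr₂, rfl, outerDomain_anti (min_le_right _ _) hr₂',
      outerDomain_anti (min_le_left _ _) hr', hq, hs, h⟩
  have i0 := hside ((0 : ℂ) : P1) (by simp [Pf_eq])
  have i1 := hside ((1 : ℂ) : P1) (by simp [Pf_eq])
  have i2 := hside ((-1 : ℂ) : P1) (by simp [Pf_eq])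
  -- Since `∞` is outside, exactly one of the three finite points must be outside too. The other
  -- five distributions leave at most one point on some side.
  rcases i0 with i0 | i0 <;> rcases i1 with i1 | i1 <;> rcases i2 with i2 | i2
  · refine (hout (a := OnePoint.infty) ?_).elim
    rintro x ⟨hx, hxP⟩
    rw [Pf_eq] at hxP
    rcases hxP with rfl | rfl | rfl | rfl
    exacts [(hno i0 hx).elim, (hno i1 hx).elim, (hno i2 hx).elim, rfl]
  · exact ⟨-1, 0, 1, i2, i0, i1, by simp⟩
  · exact ⟨1, 0, -1, i1, i0, i2, by simp⟩
  · refine (hin (a := ((0 : ℂ) : P1)) ?_).elim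
    rintro x ⟨hx, hxP⟩
    rw [Pf_eq] at hxP
    rcases hxP with rfl | rfl | rfl | rfl
    exacts [rfl, (hno hx i1).elim, (hno hx i2).elim, (hno hx hi).elim]
  · exact ⟨0, 1, -1, i0, i1, i2, by simp⟩
  · refine (hin (a := ((1 : ℂ) : P1)) ?_).elim
    rintro x ⟨hx, hxP⟩
    rw [Pf_eq] at hxP
    rcases hxP with rfl | rfl | rfl | rfl
    exacts [(hno hx i0).elim, rfl, (hno hx i2).elim, (hno hx hi).elim]
  · refine (hin (a := ((-1 : ℂ) : P1)) ?_).elim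
    rintro x ⟨hx, hxP⟩
    rw [Pf_eq] at hxP
    rcases hxP with rfl | rfl | rfl | rfl
    exacts [(hno hx i0).elim, (hno hx i1).elim, rfl, (hno hx hi).elim]
  · refine (hin (a := ((-1 : ℂ) : P1)) ?_).elim
    rintro x ⟨hx, hxP⟩
    rw [Pf_eq] at hxP
    rcases hxP with rfl | rfl | rfl | rfl
    exacts [(hno hx i0).elim, (hno hx i1).elim, (hno hx i2).elim, (hno hx hi).elim]

/-- A simple closed curve in the plane winds around the points in its interior. -/
theorem not_hasLogVariation_of_mem_innerDomain {Φ : P1 ≃ₜ P1} {d : Circle → ℂ}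
    (hd : Continuous d) (hinj : Function.Injective d)
    (hr : range (fun t => (d t : P1)) = jordanCurve Φ)
    (hi : OnePoint.infty ∈ outerDomain Φ 1) {p : ℂ} (hp : (p : P1) ∈ innerDomain Φ 1) :
    ¬ HasLogVariation (1 : Circle) 1 (fun t => d t - p) 0 := by
  rintro ⟨ℓ, hℓ, he, -⟩
  have hdc : Continuous fun t => (d t : P1) := OnePoint.continuous_coe.comp hd
  have emb : IsEmbedding fun t => (d t : P1) :=
    (hdc.isClosedEmbedding (OnePoint.coe_injective.comp hinj)).isEmbedding
  -- `ρ` reparametrizes the circle so that `d ∘ ρ` is `Φ` on the unit circle.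
  choose ρ hρ using fun t : Circle =>
    (hr ▸ coe_mem_jordanCurve.2 (Circle.norm_coe t) :
      Φ ((t : ℂ) : P1) ∈ range fun t => (d t : P1))
  have hρc : Continuous ρ := by
    rw [emb.continuous_iff]
    exact (Φ.continuous.comp (OnePoint.continuous_coe.comp continuous_subtype_val)).congr
      fun t => (hρ t).symm
  -- If `d - p = exp ℓ`, then `p + exp(sℓ)` contracts the curve in `ℂ \ {p}`. Pulled back by `Φ`,
  -- this contracts the unit circle in the sphere without meeting `Φ⁻¹(p)` and `Φ⁻¹(∞)`.
  set K : unitInterval × Circle → P1 :=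
    fun x => Φ.symm ((p + Complex.exp ((x.1 : ℝ) * ℓ (ρ x.2)) : ℂ) : P1) with hK
  have hKc : Continuous K := by
    refine Φ.symm.continuous.comp (OnePoint.continuous_coe.comp ?_)
    fun_prop
  have hK1 : ∀ t, K (1, t) = ((t : ℂ) : P1) := fun t => by
    have h1 : d (ρ t) = p + Complex.exp (ℓ (ρ t)) := by
      rw [he]
      ring
    rw [hK, Homeomorph.symm_apply_eq, ← hρ]
    simp [h1]
  have hK0 : ∀ t, K (0, t) = K (0, 1) := fun t => by simp [hK]
  have hKi : ∀ x, Φ (K x) ≠ OnePoint.infty := fun x => by simp [hK]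
  have hKp : ∀ x, Φ (K x) ≠ p := fun x => by simp [hK]
  obtain ⟨w, hw, hwp⟩ : ∃ w : ℂ, ‖w‖ < 1 ∧ Φ w = p := by
    obtain ⟨_, ⟨w, hw, rfl⟩, hwp⟩ := hp
    exact ⟨w, by simpa using hw, hwp⟩
  refine not_hasLogVariation_circle_sub hw ?_
  obtain ⟨q, hq⟩ := Φ.surjective OnePoint.infty
  induction q using OnePoint.rec with
  | infty =>
    obtain ⟨k, hk, hkK⟩ := exists_continuous_coe_eq hKc (fun x hx => hKi x (by rw [hx, hq]))
    have := HasLogVariation.of_family (X := unitInterval) (Y := Circle) (y₀ := 1) (y₁ := 1)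
      (c := 0) (k := 1) (G := fun s t => k (s, t) - w) (hk.sub continuous_const)
      (fun s t h => hKp (s, t) (by rw [← hkK, sub_eq_zero.1 h, hwp])) (fun s => by simp) 0 1
      ((HasLogVariation.const (a := k (0, 1) - w)
        (fun h => hKp (0, 1) (by rw [← hkK, sub_eq_zero.1 h, hwp]))).congr fun t => by
        have : k (0, t) = k (0, 1) := OnePoint.coe_injective (by rw [hkK, hkK, hK0])
        rw [this])
    exact this.congr fun t => by
      rw [OnePoint.coe_injective ((hkK (1, t)).trans (hK1 t))]
  | coe w' =>
    have hw' : 1 < ‖w'‖ := by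
      rw [← hq] at hi
      exact coe_mem_outerDomain.1 hi
    have hKw' : ∀ x, K x ≠ w' := fun x hx => hKi x (by rw [hx, hq])
    -- The contraction may pass through `∞`, so `z - w` is replaced by `(z - w)/(z - w') = 1 + (w' -
    -- w)/(z - w')`, with zero `w` and pole `w'`. Its denominator does not wind along the unit
    -- circle because `w'` lies outside.
    have hne : ∀ x, 1 + (w' - w) * invSub w' (K x) ≠ 0 := by
      intro x
      have h1 := hKw' x
      have h2 := hKp x
      generalize K x = y at h1 h2
      induction y using OnePoint.rec with
      | infty => simp [invSub_infty]
      | coe z =>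
        have h3 : z - w' ≠ 0 := sub_ne_zero.2 fun h => h1 (by rw [h])
        intro h0
        rw [invSub_coe] at h0
        field_simp at h0
        exact h2 (by rw [← hwp, (by linear_combination h0 : z = w)])
    have hc : Continuous fun x => 1 + (w' - w) * invSub w' (K x) :=
      continuous_const.add (continuous_const.mul (continuous_iff_continuousAt.2 fun x =>
        (continuousAt_invSub (hKw' x)).comp hKc.continuousAt))
    have := HasLogVariation.of_family (X := unitInterval) (Y := Circle) (y₀ := 1) (y₁ := 1)
      (c := 0) (k := 1) (G := fun s t => 1 + (w' - w) * invSub w' (K (s, t))) hc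
      (fun s t => hne _) (fun s => by simp) 0 1
      ((HasLogVariation.const (hne (0, 1))).congr fun t => by rw [hK0 t])
    have h2 := (this.mul (hasLogVariation_circle_sub hw')).congr
      (v := fun t : Circle => (t : ℂ) - w) fun t => by
        have h3 : (t : ℂ) - w' ≠ 0 := fun h => by
          have := sub_eq_zero.1 h
          rw [← this, Circle.norm_coe] at hw'
          exact lt_irrefl _ hw'
        rw [hK1, invSub_coe]
        field_simp
        ring
    rwa [add_zero] at h2

/-! ### Thurston's linear map of the quartic vanishes -/

section Preimage

variable {Φ : P1 ≃ₜ P1} {c : Circle → ℂ}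

theorem isPreconnected_preimage_quartic {V : Set P1} (hV : IsOpen V) (hVc : IsPreconnected V)
    (hi : OnePoint.infty ∈ V) : IsPreconnected (quartic ⁻¹' V) := by
  refine isPreconnected_preimage_of_unique continuous_quartic isOpenMap_quartic hV hVc
    (x₀ := OnePoint.infty) hi fun x hx => ?_
  rw [quartic_eq, quartic_infty] at hx
  exact quadratic_eq_infty (quadratic_eq_infty hx)

theorem isPreconnected_preimage_quadratic {b k : ℂ} (hb : b ≠ 0) {V : Set P1} (hV : IsOpen V)
    (hVc : IsPreconnected V) (hi : OnePoint.infty ∈ V) :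
    IsPreconnected (quadratic b k ⁻¹' V) :=
  isPreconnected_preimage_of_unique (continuous_quadratic hb k) (isOpenMap_quadratic hb k) hV hVc
    (x₀ := OnePoint.infty) hi fun _ hx => quadratic_eq_infty hx

/-- A loop over a simple closed curve does not wind around the points whose image lies in the
component of `∞`. -/
theorem hasLogVariation_of_quartic_mem_outer (hc : Continuous c)
    (hcγ : ∀ t, quartic (c t) ∈ jordanCurve Φ) (hi : OnePoint.infty ∈ outerDomain Φ 1) {p : ℂ}
    (hp : quartic p ∈ outerDomain Φ 1) : HasLogVariation (1 : Circle) 1 (fun t => c t - p) 0 :=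
  hasLogVariation_sub_of_infty_mem (K := quartic ⁻¹' outerDomain Φ 1)
    (isPreconnected_preimage_quartic isOpen_outerDomain (isPreconnected_outerDomain zero_lt_one) hi)
    hc rfl (fun t => disjoint_left.1 disjoint_jordanCurve_outerDomain (hcγ t)) hi hp

/-- A loop over a simple closed curve does not wind around the points in the other components of the
preimage of a neighbourhood of the inner domain. -/
theorem hasLogVariation_of_notMem_component {r : ℝ} (hr : 1 < r) (hc : Continuous c)
    (hcγ : ∀ t, quartic (c t) ∈ jordanCurve Φ) (hi : OnePoint.infty ∈ outerDomain Φ 1) {p : ℂ}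
    (hp : quartic p ∈ innerDomain Φ r)
    (hpQ : (p : P1) ∉ connectedComponentIn (quartic ⁻¹' innerDomain Φ r) (c 1)) :
    HasLogVariation (1 : Circle) 1 (fun t => c t - p) 0 := by
  set Q := connectedComponentIn (quartic ⁻¹' innerDomain Φ r) (p : P1) with hQ
  have hpQ' : (p : P1) ∈ Q := mem_connectedComponentIn hp
  -- `Q` maps onto the enlarged disc, so it meets the preimage of the exterior over the collar.
  -- Their union joins `p` to `∞` off the loop.
  obtain ⟨y, hy, hy'⟩ := inner_inter_outer_nonempty (Φ := Φ) zero_le_one hr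
  obtain ⟨x, hx, rfl⟩ := image_connectedComponentIn_preimage continuous_quartic isOpenMap_quartic
    isOpen_innerDomain isPreconnected_innerDomain hp hy
  have hrange : range (fun t => (c t : P1)) ⊆
      connectedComponentIn (quartic ⁻¹' innerDomain Φ r) (c 1) :=
    (isPreconnected_range (OnePoint.continuous_coe.comp hc)).subset_connectedComponentIn
      (mem_range_self (1 : Circle))
      (range_subset_iff.2 fun t => jordanCurve_subset_innerDomain hr (hcγ t))
  refine hasLogVariation_sub_of_infty_mem (K := Q ∪ quartic ⁻¹' outerDomain Φ 1)
    (IsPreconnected.union x hx hy' isPreconnected_connectedComponentIn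
      (isPreconnected_preimage_quartic isOpen_outerDomain
        (isPreconnected_outerDomain zero_lt_one) hi))
    hc rfl ?_ (Or.inr hi) (Or.inl hpQ')
  rintro t (h | h)
  · refine hpQ ?_
    rw [connectedComponentIn_eq (hrange (mem_range_self t)), ← connectedComponentIn_eq h]
    exact hpQ'
  · exact disjoint_left.1 disjoint_jordanCurve_outerDomain (hcγ t) h

theorem joinedIn_component {r : ℝ} {F : P1 → P1} (hF : Continuous F) {x y z : P1}
    (hy : y ∈ connectedComponentIn (F ⁻¹' innerDomain Φ r) x)
    (hz : z ∈ connectedComponentIn (F ⁻¹' innerDomain Φ r) x) :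
    JoinedIn (connectedComponentIn (F ⁻¹' innerDomain Φ r) x) y z := by
  have ho : IsOpen (connectedComponentIn (F ⁻¹' innerDomain Φ r) x) :=
    (isOpen_innerDomain.preimage hF).connectedComponentIn
  exact (ho.isConnected_iff_isPathConnected.1
    ⟨⟨y, hy⟩, isPreconnected_connectedComponentIn⟩).joinedIn y hy z hz

/-- A loop over a curve that encloses `0` and `1`, but not `-1`, winds around at most one of the
points `1` and `-1`. -/
theorem hasLogVariation_of_neg_one_mem_outer {r : ℝ} (hr : 1 < r) (hc : Continuous c)
    (hcγ : ∀ t, quartic (c t) ∈ jordanCurve Φ) (hi : OnePoint.infty ∈ outerDomain Φ r)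
    (h1 : ((1 : ℂ) : P1) ∈ innerDomain Φ 1) (hm : ((-1 : ℂ) : P1) ∈ outerDomain Φ r) :
    HasLogVariation (1 : Circle) 1 (fun t => c t - 1) 0 ∨
      HasLogVariation (1 : Circle) 1 (fun t => c t - (-1)) 0 := by
  have hi' := outerDomain_anti hr.le hi
  have h1' := innerDomain_mono hr.le h1
  by_contra! hcon
  have hQ1 : ((1 : ℂ) : P1) ∈ connectedComponentIn (quartic ⁻¹' innerDomain Φ r) (c 1) := by
    by_contra h
    exact hcon.1 (hasLogVariation_of_notMem_component hr hc hcγ hi' (by rwa [quartic_one]) h)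
  have hQm : ((-1 : ℂ) : P1) ∈ connectedComponentIn (quartic ⁻¹' innerDomain Φ r) (c 1) := by
    by_contra h
    exact hcon.2 (hasLogVariation_of_notMem_component hr hc hcγ hi' (by rwa [quartic_neg_one]) h)
  -- As `g(0) = -1` is outside, the connected set `g⁻¹(exterior)` contains both critical values `0`
  -- and `∞` of the square. So `1` and `-1` cannot be joined over its complement.
  have hL := isPreconnected_preimage_quadratic (b := 2 * Complex.I) (k := kappa)
    two_mul_I_ne_zero isOpen_outerDomain
    (isPreconnected_outerDomain (Φ := Φ) (zero_lt_one.trans hr)) hi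
  refine not_joinedIn_quadratic (b := 1) (k := 0) (a := 1) one_ne_zero hL ?_ hi ?_
  · have : quadratic (2 * Complex.I) kappa ((0 : ℂ) : P1) = ((-1 : ℂ) : P1) := by
      rw [← quartic_zero, quartic_eq]
      simp [quadratic_coe]
    rwa [mem_preimage, this]
  · rw [zero_add, zero_sub]
    refine (joinedIn_component continuous_quartic hQ1 hQm).mono fun x hx hx' => ?_
    have := connectedComponentIn_subset _ _ hx
    rw [mem_preimage, quartic_eq] at this
    exact (disjoint_inner_outer le_rfl).le_bot ⟨this, hx'⟩

/-- A loop over a curve that encloses `1` and `-1`, but not `0`, winds around all three points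
`0`, `1`, `-1` or around at most one of them. -/
theorem hasLogVariation_of_zero_mem_outer {r : ℝ} (hr : 1 < r) (hc : Continuous c)
    (hcγ : ∀ t, quartic (c t) ∈ jordanCurve Φ) (hi : OnePoint.infty ∈ outerDomain Φ r)
    (h0 : ((0 : ℂ) : P1) ∈ outerDomain Φ r) (h1 : ((1 : ℂ) : P1) ∈ innerDomain Φ 1)
    (hm : ((-1 : ℂ) : P1) ∈ innerDomain Φ 1) :
    (∀ p ∈ ({0, 1, -1} : Set ℂ), ∀ q ∈ ({0, 1, -1} : Set ℂ),
      HasLogVariation (1 : Circle) 1 (fun t => c t - p) 0 →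
      HasLogVariation (1 : Circle) 1 (fun t => c t - q) 0) ∨
    (∀ p ∈ ({0, 1, -1} : Set ℂ), ∀ q ∈ ({0, 1, -1} : Set ℂ), p ≠ q →
      HasLogVariation (1 : Circle) 1 (fun t => c t - p) 0 ∨
      HasLogVariation (1 : Circle) 1 (fun t => c t - q) 0) := by
  obtain ⟨s, hs1, hsr⟩ := exists_between hr
  set g := quadratic (2 * Complex.I) kappa with hg
  have hgc : Continuous g := continuous_quadratic two_mul_I_ne_zero _
  have hgo : IsOpenMap g := isOpenMap_quadratic two_mul_I_ne_zero _
  have hsqc : Continuous (quadratic 1 0) := continuous_quadratic one_ne_zero _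
  have hsqo : IsOpenMap (quadratic 1 0) := isOpenMap_quadratic one_ne_zero _
  have hsq0 : quadratic 1 0 ((0 : ℂ) : P1) = ((0 : ℂ) : P1) := by simp [quadratic_coe]
  have hsq1 : quadratic 1 0 ((1 : ℂ) : P1) = ((1 : ℂ) : P1) := by simp [quadratic_coe]
  have hsqm : quadratic 1 0 ((-1 : ℂ) : P1) = ((1 : ℂ) : P1) := by simp [quadratic_coe]
  have hg0 : g ((0 : ℂ) : P1) = ((-1 : ℂ) : P1) := by
    rw [← quartic_zero, quartic_eq, hsq0]
  have hg1 : g ((1 : ℂ) : P1) = ((1 : ℂ) : P1) := by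
    conv_rhs => rw [← quartic_one, quartic_eq, hsq1]
  have hin1 : ((1 : ℂ) : P1) ∈ g ⁻¹' innerDomain Φ 1 := by rwa [mem_preimage, hg1]
  have hinr : ((1 : ℂ) : P1) ∈ g ⁻¹' innerDomain Φ r := innerDomain_mono hr.le hin1
  -- The critical value `0` of `g` is outside, so `g` is unbranched over the disc. The question is
  -- whether `1` and the preimage `0` of `-1` under `g` lie in the same component.
  by_cases h : ((0 : ℂ) : P1) ∈ connectedComponentIn (g ⁻¹' innerDomain Φ r) ((1 : ℂ) : P1)
  · left
    set R := connectedComponentIn (g ⁻¹' innerDomain Φ 1) ((1 : ℂ) : P1) with hR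
    have hRsub : R ⊆ connectedComponentIn (g ⁻¹' innerDomain Φ r) ((1 : ℂ) : P1) :=
      connectedComponentIn_mono _ (preimage_mono (innerDomain_mono hr.le))
    have h0R : ((0 : ℂ) : P1) ∈ R := by
      obtain ⟨x, hx, hxm⟩ := image_connectedComponentIn_preimage hgc hgo isOpen_innerDomain
        isPreconnected_innerDomain hin1 hm
      -- These two points are the fibre of `g` over `-1`, symmetric about `κ`. They cannot share a
      -- component.
      have hx2 : x = ((0 : ℂ) : P1) ∨ x = ((2 * kappa : ℂ) : P1) := by
        induction x using OnePoint.rec with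
        | infty => exact absurd hxm (OnePoint.infty_ne_coe _)
        | coe z =>
          have h3 : 2 * Complex.I * (z - kappa) ^ 2 = -1 := OnePoint.coe_injective hxm
          have h4 : z * (z - 2 * kappa) = 0 := by
            refine (mul_eq_zero.1 (?_ : (2 * Complex.I) * (z * (z - 2 * kappa)) = 0)).resolve_left
              two_mul_I_ne_zero
            linear_combination h3 - Complex.I * kappa_sq - Complex.I_sq
          rcases mul_eq_zero.1 h4 with h5 | h5
          · exact Or.inl (by rw [h5])
          · exact Or.inr (by rw [sub_eq_zero.1 h5])
      rcases hx2 with rfl | rfl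
      · exact hx
      · refine (not_joinedIn_quadratic (b := 2 * Complex.I) (k := kappa) (a := kappa)
          two_mul_I_ne_zero (isPreconnected_outerDomain (zero_lt_one.trans hr)) h0 hi ?_).elim
        rw [sub_self, ← two_mul]
        refine (joinedIn_component hgc (hRsub hx) h).mono fun x hx hx' => ?_
        have hx2 := connectedComponentIn_subset _ _ hx
        exact (disjoint_inner_outer le_rfl).le_bot ⟨hx2, hx'⟩
    have hRo : IsOpen R := (isOpen_innerDomain.preimage hgc).connectedComponentIn
    -- `R` contains the branch value `0` of the square, so its preimage is a connected set
    -- containing `0`, `1`, `-1`. It lies over the open disc, hence off the loop.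
    have hS : IsPreconnected (quadratic 1 0 ⁻¹' R) := by
      refine isPreconnected_preimage_of_unique hsqc hsqo hRo isPreconnected_connectedComponentIn
        (x₀ := ((0 : ℂ) : P1)) (by rwa [hsq0]) fun x hx => ?_
      rw [hsq0] at hx
      induction x using OnePoint.rec with
      | infty => exact absurd hx (OnePoint.infty_ne_coe _)
      | coe z =>
        have h3 : 1 * (z - 0) ^ 2 = 0 := OnePoint.coe_injective hx
        have h4 : z = 0 := by simpa using h3
        rw [h4]
    have hmem : ∀ p ∈ ({0, 1, -1} : Set ℂ), (p : P1) ∈ quadratic 1 0 ⁻¹' R := by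
      have h1R : ((1 : ℂ) : P1) ∈ R := mem_connectedComponentIn hin1
      rintro p (rfl | rfl | rfl)
      · rwa [mem_preimage, hsq0]
      · rwa [mem_preimage, hsq1]
      · rwa [mem_preimage, hsqm]
    intro p hp q hq
    refine hasLogVariation_sub_of_mem hS hc rfl (fun t ht => ?_) (hmem p hp) (hmem q hq)
    have := connectedComponentIn_subset _ _ ht
    rw [mem_preimage, hg, ← quartic_eq] at this
    exact disjoint_left.1 disjoint_jordanCurve_innerDomain (hcγ t) this
  · right
    have hi' := outerDomain_anti hr.le hi
    -- The radius `s` exceeds `1` so that `Q` contains the loop, and is below `r` so that the disc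
    -- of radius `r` overlaps the exterior of radius `s`.
    set Q := connectedComponentIn (quartic ⁻¹' innerDomain Φ s) (c 1) with hQ
    have hQN : ∀ p ∈ ({0, 1, -1} : Set ℂ), (p : P1) ∉ Q →
        HasLogVariation (1 : Circle) 1 (fun t => c t - p) 0 := by
      intro p hp hpQ
      refine hasLogVariation_of_notMem_component hs1 hc hcγ hi' (innerDomain_mono hs1.le ?_) hpQ
      rcases hp with rfl | rfl | rfl
      · rwa [quartic_zero]
      · rwa [quartic_one]
      · rwa [quartic_neg_one]
    have hsQ : IsPreconnected (quadratic 1 0 '' Q) :=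
      isPreconnected_connectedComponentIn.image _ hsqc.continuousOn
    have hsQsub : quadratic 1 0 '' Q ⊆ g ⁻¹' innerDomain Φ s := by
      rintro _ ⟨x, hx, rfl⟩
      have := connectedComponentIn_subset _ _ hx
      rwa [mem_preimage, quartic_eq] at this
    have hsQR : ((1 : ℂ) : P1) ∈ quadratic 1 0 '' Q → quadratic 1 0 '' Q ⊆
        connectedComponentIn (g ⁻¹' innerDomain Φ r) ((1 : ℂ) : P1) := fun h1Q =>
      hsQ.subset_connectedComponentIn h1Q
        (hsQsub.trans (preimage_mono (innerDomain_mono hsr.le)))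
    have hA : ∀ p : ℂ, quadratic 1 0 (p : P1) = ((1 : ℂ) : P1) → ((0 : ℂ) : P1) ∈ Q →
        (p : P1) ∉ Q := fun p hp h0Q hpQ =>
      h (hsQR ⟨_, hpQ, hp⟩ ⟨_, h0Q, hsq0⟩)
    -- If `1 ∈ Q`, then the squares of `Q` lie in the component of `1`. So they avoid the component
    -- `R₀` of `0`, and also `g⁻¹(exterior)`, which together join `0` to `∞`.
    have hB : ((1 : ℂ) : P1) ∈ Q → ((-1 : ℂ) : P1) ∉ Q := by
      intro h1Q hmQ
      have hinr0 : ((0 : ℂ) : P1) ∈ g ⁻¹' innerDomain Φ r := by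
        rw [mem_preimage, hg0]
        exact innerDomain_mono hr.le hm
      set R₀ := connectedComponentIn (g ⁻¹' innerDomain Φ r) ((0 : ℂ) : P1) with hR₀
      have h0R₀ : ((0 : ℂ) : P1) ∈ R₀ := mem_connectedComponentIn hinr0
      obtain ⟨y, hy, hy'⟩ := inner_inter_outer_nonempty (Φ := Φ) (zero_le_one.trans hs1.le) hsr
      obtain ⟨x, hx, rfl⟩ := image_connectedComponentIn_preimage hgc hgo
        isOpen_innerDomain isPreconnected_innerDomain hinr0 hy
      have his := outerDomain_anti hsr.le hi
      have hL : IsPreconnected (R₀ ∪ g ⁻¹' outerDomain Φ s) :=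
        IsPreconnected.union x hx hy' isPreconnected_connectedComponentIn
          (isPreconnected_preimage_quadratic two_mul_I_ne_zero isOpen_outerDomain
            (isPreconnected_outerDomain (zero_lt_one.trans hs1)) his)
      refine not_joinedIn_quadratic (b := 1) (k := 0) (a := 1) one_ne_zero hL (Or.inl h0R₀)
        (Or.inr his) ?_
      rw [zero_add, zero_sub]
      refine (joinedIn_component continuous_quartic h1Q hmQ).mono fun x hx hx' => ?_
      have hxQ : quadratic 1 0 x ∈ quadratic 1 0 '' Q := mem_image_of_mem _ hx
      rcases hx' with hx' | hx'
      · have h5 := hsQR ⟨_, h1Q, hsq1⟩ hxQ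
        refine h ?_
        rw [connectedComponentIn_eq h5, ← connectedComponentIn_eq hx']
        exact h0R₀
      · exact (disjoint_inner_outer le_rfl).le_bot ⟨hsQsub hxQ, hx'⟩
    have hmain : ∀ p ∈ ({0, 1, -1} : Set ℂ), ∀ q ∈ ({0, 1, -1} : Set ℂ), p ≠ q →
        (p : P1) ∈ Q → (q : P1) ∉ Q := by
      rintro p (rfl | rfl | rfl) q (rfl | rfl | rfl) hpq hpQ hqQ
      all_goals first
        | exact hpq rfl
        | exact hA _ hsq1 ‹_› ‹_›
        | exact hA _ hsqm ‹_› ‹_›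
        | exact hB ‹_› ‹_›
    intro p hp q hq hpq
    by_cases hpQ : (p : P1) ∈ Q
    · exact Or.inr (hQN q hq (hmain p hp q hq hpq hpQ))
    · exact Or.inl (hQN p hp hpQ)

end Preimage

/-- No component of the preimage of an essential curve is homotopic to an essential curve. -/
theorem not_freelyHomotopic_of_mem_preimageComponents {γ δ ε : Set P1}
    (hγ : IsEssentialCurve Pf γ) (hε : IsEssentialCurve Pf ε)
    (hδ : δ ∈ preimageComponents quartic γ) : ¬ FreelyHomotopic Pf δ ε := by
  rintro ⟨c, d, ⟨-, hc⟩, ⟨hdi, hd⟩, ⟨H⟩⟩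
  have hiP : OnePoint.infty ∈ Pf := by simp [Pf_eq]
  have hPne : ∀ {p : P1}, p ∈ Pf → ∀ x : (Pfᶜ : Set P1), (x : P1) ≠ p := fun hp x hx =>
    x.2 (hx ▸ hp)
  obtain ⟨K, hKc, hK⟩ := exists_continuous_coe_eq (continuous_subtype_val.comp H.continuous)
    (fun x => hPne hiP _)
  have hK0 : ∀ t, ((K (0, t) : ℂ) : P1) = c t := fun t => (hK (0, t)).trans (by simp)
  have hK1 : ∀ t, ((K (1, t) : ℂ) : P1) = d t := fun t => (hK (1, t)).trans (by simp)
  have hKp : ∀ {p : ℂ}, (p : P1) ∈ Pf →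
      (HasLogVariation (1 : Circle) 1 (fun t => K (0, t) - p) 0 ↔
        HasLogVariation (1 : Circle) 1 (fun t => K (1, t) - p) 0) := by
    intro p hp
    have key : ∀ s s' : unitInterval, HasLogVariation (1 : Circle) 1 (fun t => K (s, t) - p) 0 →
        HasLogVariation (1 : Circle) 1 (fun t => K (s', t) - p) 0 :=
      HasLogVariation.of_family (G := fun s t => K (s, t) - p) (k := 1)
        (hKc.sub continuous_const)
        (fun s t h => hPne hp (H (s, t)) (by rw [← sub_eq_zero.1 h]; exact (hK (s, t)).symm))
        (fun s => by simp)
    exact ⟨key 0 1, key 1 0⟩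
  have hdc : Continuous fun t => K (1, t) := by fun_prop
  have hcc : Continuous fun t => K (0, t) := by fun_prop
  obtain ⟨Ψ, r', p', q', s', hr', rfl, hi', hp', hq', hs', hcases'⟩ := exists_domains_of_isEssentialCurve hε
  have hinj : Function.Injective fun t => K (1, t) := fun t t' h => hdi <| Subtype.ext <| by
    rw [← hK1, ← hK1]
    exact congrArg _ h
  have hrange : range (fun t => ((K (1, t) : ℂ) : P1)) = jordanCurve Ψ := by
    rw [← hd]
    exact congrArg range (funext hK1)
  have hi1 := outerDomain_anti hr'.le hi'
  have hmemP : ∀ p ∈ ({0, 1, -1} : Set ℂ), (p : P1) ∈ Pf := by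
    rintro p (rfl | rfl | rfl) <;> simp [Pf_eq]
  have hNp : HasLogVariation (1 : Circle) 1 (fun t => K (1, t) - p') 0 :=
    hasLogVariation_sub_of_infty_mem (isPreconnected_outerDomain (Φ := Ψ) zero_lt_one) hdc rfl
      (fun t => disjoint_left.1 disjoint_jordanCurve_outerDomain (hrange ▸ mem_range_self t)) hi1
      (outerDomain_anti hr'.le hp')
  have hNq := not_hasLogVariation_of_mem_innerDomain hdc hinj hrange hi1 hq'
  have hNs := not_hasLogVariation_of_mem_innerDomain hdc hinj hrange hi1 hs'
  have hP' : p' ∈ ({0, 1, -1} : Set ℂ) := by rcases hcases' with h | h | h <;> simp [h.1]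
  have hQ' : q' ∈ ({0, 1, -1} : Set ℂ) := by rcases hcases' with h | h | h <;> simp [h.2.1]
  have hS' : s' ∈ ({0, 1, -1} : Set ℂ) := by rcases hcases' with h | h | h <;> simp [h.2.2]
  have hqs : q' ≠ s' := by
    rcases hcases' with ⟨-, rfl, rfl⟩ | ⟨-, rfl, rfl⟩ | ⟨-, rfl, rfl⟩ <;> norm_num
  rw [← hKp (hmemP _ hP')] at hNp
  rw [← hKp (hmemP _ hQ')] at hNq
  rw [← hKp (hmemP _ hS')] at hNs
  obtain ⟨x, hx, rfl⟩ := hδ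
  obtain ⟨Φ, r, p, q, s, hr, rfl, hi, hp, hq, hs, hcases⟩ := exists_domains_of_isEssentialCurve hγ
  have hcγ : ∀ t, quartic (K (0, t) : ℂ) ∈ jordanCurve Φ := fun t => by
    have : ((K (0, t) : ℂ) : P1) ∈ range fun t => (c t : P1) := ⟨t, (hK0 t).symm⟩
    rw [hc] at this
    have h2 := connectedComponentIn_subset _ _ this
    exact h2
  -- Being homotopic to an essential curve, the loop fails to wind around exactly one of the three
  -- points, namely `p'`.
  have hall : ∀ a ∈ ({0, 1, -1} : Set ℂ),
      HasLogVariation (1 : Circle) 1 (fun t => K (0, t) - a) 0 → a = p' := by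
    intro a ha hNa
    have haq : a ≠ q' := fun e => hNq (e ▸ hNa)
    have has : a ≠ s' := fun e => hNs (e ▸ hNa)
    clear * - ha haq has hcases'
    simp only [mem_insert_iff, mem_singleton_iff] at ha
    rcases hcases' with ⟨rfl, rfl, rfl⟩ | ⟨rfl, rfl, rfl⟩ | ⟨rfl, rfl, rfl⟩ <;> tauto
  have htwo : ∀ a ∈ ({0, 1, -1} : Set ℂ), ∀ b ∈ ({0, 1, -1} : Set ℂ), a ≠ b →
      HasLogVariation (1 : Circle) 1 (fun t => K (0, t) - a) 0 →
      HasLogVariation (1 : Circle) 1 (fun t => K (0, t) - b) 0 → False := by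
    intro a ha b hb hab hNa hNb
    exact hab ((hall a ha hNa).trans (hall b hb hNb).symm)
  have hout : ∀ {a : ℂ}, quartic a ∈ outerDomain Φ r →
      HasLogVariation (1 : Circle) 1 (fun t => K (0, t) - a) 0 := fun ha =>
    hasLogVariation_of_quartic_mem_outer hcc hcγ (outerDomain_anti hr.le hi)
      (outerDomain_anti hr.le ha)
  rcases hcases with ⟨rfl, rfl, rfl⟩ | ⟨rfl, rfl, rfl⟩ | ⟨rfl, rfl, rfl⟩
  · rcases hasLogVariation_of_zero_mem_outer hr hcc hcγ hi hp hq hs with h | h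
    · exact hNq (h p' hP' q' hQ' hNp)
    · exact (h q' hQ' s' hS' hqs).elim hNq hNs
  · exact htwo 1 (by simp) (-1) (by simp) (by norm_num) (hout (by rwa [quartic_one]))
      (hout (by rwa [quartic_neg_one]))
  · have h0 := hout (a := 0) (by rwa [quartic_zero])
    rcases hasLogVariation_of_neg_one_mem_outer hr hcc hcγ hi hs hp with h | h
    · exact htwo 0 (by simp) 1 (by simp) (by norm_num) h0 h
    · exact htwo 0 (by simp) (-1) (by simp) (by norm_num) h0 h

theorem thurstonCoeff_quartic (a b : CurveClass Pf) : thurstonCoeff quartic Pf a b = 0 := by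
  have : {δ | δ ∈ preimageComponents quartic a.out.1 ∧ FreelyHomotopic Pf δ b.out.1} = ∅ :=
    eq_empty_of_forall_notMem fun δ hδ =>
      not_freelyHomotopic_of_mem_preimageComponents a.out.2 b.out.2 hδ.1 hδ.2
  rw [thurstonCoeff, this, finsum_mem_empty]

/-- Thurston's linear map of the quartic is zero. -/
theorem thurstonLinearMap_quartic : thurstonLinearMap quartic Pf = 0 := by
  have : (fun a : CurveClass Pf => ∑ᶠ b, Finsupp.single b (thurstonCoeff quartic Pf a b)) =
      0 := by
    funext a
    simp [thurstonCoeff_quartic]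
  rw [thurstonLinearMap, this]
  ext
  simp

/-! ### Existence of right Dehn twists -/

/-- Homotopic maps agree on `H₂`. -/
theorem isOrientationPreserving_of_homotopic {h : P1 ≃ₜ P1}
    (H : ContinuousMap.Homotopy (ContinuousMap.id P1) (h : C(P1, P1))) :
    IsOrientationPreserving h := by
  have h1 := TopCat.Homotopy.congr_homologyMap_singularChainComplexFunctor
    (X := TopCat.of P1) (Y := TopCat.of P1) (f := 𝟙 (TopCat.of P1))
    (g := TopCat.ofHom (h : C(P1, P1))) H (ModuleCat.of ℤ ℤ) 2
  have h2 : ((AlgebraicTopology.singularHomologyFunctor (ModuleCat.{0} ℤ) 2).obj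
      (ModuleCat.of ℤ ℤ)).map (𝟙 (TopCat.of P1)) = 𝟙 _ := CategoryTheory.Functor.map_id _ _
  exact h1.symm.trans h2

/-- A homeomorphism of the plane that is the identity outside a bounded set preserves
orientation. -/
theorem isOrientationPreserving_onePointCongr {τ : ℂ ≃ₜ ℂ} {r : ℝ}
    (hτ : ∀ z, r < ‖z‖ → τ z = z) : IsOrientationPreserving τ.onePointCongr := by
  -- The straight-line homotopy is stationary near `∞`, hence continuous there. The intermediate
  -- maps need not be homeomorphisms.
  let F : unitInterval × P1 → P1 := fun q =>
    q.2.elim OnePoint.infty fun z => ((z + (q.1 : ℝ) * (τ z - z) : ℂ) : P1)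
  have hFcoe : ∀ s (z : ℂ), F (s, (z : P1)) = ((z + (s : ℝ) * (τ z - z) : ℂ) : P1) :=
    fun _ _ => rfl
  have hFi : ∀ s, F (s, OnePoint.infty) = OnePoint.infty := fun _ => rfl
  have hF : Continuous F := by
    rw [continuous_iff_continuousAt]
    rintro ⟨s, x⟩
    induction x using OnePoint.rec with
    | infty =>
      have hU : ∀ᶠ q : unitInterval × P1 in 𝓝 (s, OnePoint.infty), F q = q.2 := by
        have h1 : ((fun z : ℂ => (z : P1)) '' Metric.closedBall (0 : ℂ) r)ᶜ ∈
            𝓝 (OnePoint.infty : P1) :=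
          (OnePoint.isOpen_compl_image_coe.2 ⟨Metric.isClosed_closedBall,
            isCompact_closedBall _ _⟩).mem_nhds (by simp)
        filter_upwards [continuous_snd.continuousAt.preimage_mem_nhds h1]
        rintro ⟨s, x⟩ hx
        induction x using OnePoint.rec with
        | infty => rfl
        | coe z =>
          have hz : r < ‖z‖ := by
            by_contra hz
            exact hx ⟨z, by simpa using hz, rfl⟩
          rw [hFcoe, hτ z hz, sub_self, mul_zero, add_zero]
      exact (continuous_snd.continuousAt (x := (s, OnePoint.infty))).congr
        (hU.mono fun q hq => hq.symm)
    | coe z =>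
      have he : IsOpenEmbedding (Prod.map id ((↑) : ℂ → P1) : unitInterval × ℂ → _) :=
        IsOpenEmbedding.id.prodMap OnePoint.isOpenEmbedding_coe
      have := he.continuousAt_iff (g := F) (x := (s, z))
      refine this.1 (Continuous.continuousAt ?_)
      refine OnePoint.continuous_coe.comp (?_ : Continuous fun q : unitInterval × ℂ =>
        q.2 + ((q.1 : ℝ) : ℂ) * (τ q.2 - q.2))
      have := τ.continuous
      fun_prop
  refine isOrientationPreserving_of_homotopic ⟨⟨F, hF⟩, fun x => ?_, fun x => ?_⟩
  · induction x using OnePoint.rec with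
    | infty => rfl
    | coe z =>
      change F (0, (z : P1)) = _
      simp [hFcoe]
  · induction x using OnePoint.rec with
    | infty => rfl
    | coe z =>
      change F (1, (z : P1)) = ((τ z : ℂ) : P1)
      simp [hFcoe]

/-- The map `z ↦ z exp(2πi σ t)`, where `t` is `|z| - 1` truncated to `[0,1]`. -/
noncomputable def fullTwist (σ : ℝ) (z : ℂ) : ℂ :=
  z * Complex.exp ((σ * (2 * π * max 0 (min (‖z‖ - 1) 1)) : ℝ) * Complex.I)

theorem norm_fullTwist (σ : ℝ) (z : ℂ) : ‖fullTwist σ z‖ = ‖z‖ := by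
  rw [fullTwist, norm_mul, Complex.norm_exp_ofReal_mul_I, mul_one]

theorem continuous_fullTwist (σ : ℝ) : Continuous (fullTwist σ) := by
  unfold fullTwist
  fun_prop

/-- A twist preserves `‖z‖`, on which the angle depends, so angles add under composition. -/
theorem fullTwist_fullTwist {σ σ' : ℝ} (h : σ + σ' = 0) (z : ℂ) :
    fullTwist σ (fullTwist σ' z) = z := by
  rw [fullTwist, norm_fullTwist, fullTwist, mul_assoc, ← Complex.exp_add, ← add_mul,
    ← Complex.ofReal_add, ← add_mul, add_comm σ', h]
  simp

theorem fullTwist_of_mem_annulus {z : ℂ} (hz : z ∈ annulus) :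
    fullTwist (-1) z = stdRightTwist z := by
  have h1 : max 0 (min (‖z‖ - 1) 1) = ‖z‖ - 1 := by
    rw [min_eq_left (by linarith [hz.2]), max_eq_right (by linarith [hz.1])]
  rw [fullTwist, stdRightTwist, h1]
  push_cast
  ring_nf

theorem fullTwist_of_notMem_annulus {z : ℂ} (hz : z ∉ annulus) : fullTwist (-1) z = z := by
  rw [fullTwist]
  rcases lt_or_ge ‖z‖ 1 with h | h
  · have h1 : max 0 (min (‖z‖ - 1) 1) = 0 :=
      max_eq_left ((min_le_left _ _).trans (by linarith))
    simp [h1]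
  · have h2 : 2 < ‖z‖ := by
      by_contra h2
      exact hz ⟨h, not_lt.1 h2⟩
    have h1 : max 0 (min (‖z‖ - 1) 1) = 1 := by
      rw [min_eq_right (by linarith), max_eq_right zero_le_one]
    have h3 : Complex.exp ((-1 * (2 * π * 1) : ℝ) * Complex.I) = 1 := by
      rw [Complex.exp_eq_one_iff]
      exact ⟨-1, by push_cast; ring⟩
    rw [h1, h3, mul_one]

/-- The twist of the plane supported on the annulus `1 ≤ |z| ≤ 2`. -/
noncomputable def fullTwistHomeo : ℂ ≃ₜ ℂ where
  toFun := fullTwist (-1)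
  invFun := fullTwist 1
  left_inv := fullTwist_fullTwist (by norm_num)
  right_inv := fullTwist_fullTwist (by norm_num)
  continuous_toFun := continuous_fullTwist _
  continuous_invFun := continuous_fullTwist _

/-- The similarity `z ↦ 1/2 + 2z/3`, which takes the annulus `1 ≤ |z| ≤ 2` to an annulus that
separates `0, 1` from `-1`. -/
noncomputable def annulusChart : ℂ ≃ₜ ℂ :=
  (Homeomorph.mulLeft₀ (2 / 3 : ℂ) (by norm_num)).trans (Homeomorph.addLeft (1 / 2 : ℂ))

theorem annulusChart_apply (z : ℂ) : annulusChart z = 1 / 2 + 2 / 3 * z := rfl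

theorem norm_annulusChart_symm (w : ℂ) : ‖annulusChart.symm w‖ = 3 / 2 * ‖w - 1 / 2‖ := by
  obtain ⟨z, rfl⟩ := annulusChart.surjective w
  rw [annulusChart.symm_apply_apply, annulusChart_apply, add_sub_cancel_left, norm_mul]
  norm_num
  ring

/-- A right Dehn twist about the circle of radius `1` about `1/2`. -/
noncomputable def dehnTwistPlane : ℂ ≃ₜ ℂ :=
  annulusChart.symm.trans (fullTwistHomeo.trans annulusChart)

theorem dehnTwistPlane_apply (w : ℂ) :
    dehnTwistPlane w = annulusChart (fullTwist (-1) (annulusChart.symm w)) := rfl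

theorem dehnTwistPlane_eq_self {w : ℂ} (hw : annulusChart.symm w ∉ annulus) :
    dehnTwistPlane w = w := by
  rw [dehnTwistPlane_apply, fullTwist_of_notMem_annulus hw, annulusChart.apply_symm_apply]

/-- The image annulus has centre `1/2` and radii `2/3` and `4/3`. The points `0, 1` are at distance
`1/2` from the centre and `-1` is at distance `3/2`. -/
theorem annulusChart_symm_notMem {w : ℂ} (hw : w ∈ ({0, 1, -1} : Set ℂ)) :
    annulusChart.symm w ∉ annulus := by
  rintro ⟨h1, h2⟩
  rw [norm_annulusChart_symm] at h1 h2
  rcases hw with rfl | rfl | rfl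
  · norm_num at h1
  · norm_num at h1
  · norm_num at h2

theorem dehnTwistPlane_mem_pureHomeo : dehnTwistPlane.onePointCongr ∈ pureHomeo Pf := by
  refine ⟨isOrientationPreserving_onePointCongr (r := 2) fun w hw => ?_, ?_⟩
  · refine dehnTwistPlane_eq_self fun h => ?_
    have h2 := h.2
    rw [norm_annulusChart_symm] at h2
    have := norm_sub_norm_le w (1 / 2)
    norm_num at this h2
    linarith
  · intro p hp
    have key : ∀ w ∈ ({0, 1, -1} : Set ℂ), dehnTwistPlane.onePointCongr (w : P1) = w :=
      fun w hw => congrArg _ (dehnTwistPlane_eq_self (annulusChart_symm_notMem hw))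
    rw [Pf_eq] at hp
    rcases hp with rfl | rfl | rfl | rfl
    · exact key _ (by simp)
    · exact key _ (by simp)
    · exact key _ (by simp)
    · rfl

theorem exists_isRightDehnTwist : ∃ D : Set ℂ, IsRegularNhdUnitSegment D ∧
    ∃ T : pureHomeo Pf, IsRightDehnTwist Pf (boundaryCurve D) (T : P1 ≃ₜ P1) := by
  refine ⟨Metric.closedBall (1 / 2) 1, ⟨⟨Homeomorph.addLeft (1 / 2 : ℂ), ?_⟩, ?_, ?_⟩,
    ⟨dehnTwistPlane.onePointCongr, dehnTwistPlane_mem_pureHomeo⟩, ?_⟩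
  · simp
  · rw [interior_closedBall _ one_ne_zero]
    refine (convex_ball _ _).segment_subset ?_ ?_ <;> rw [mem_ball_iff_norm] <;> norm_num
  · rw [mem_closedBall_iff_norm]
    norm_num
  · let φ : OpenPartialHomeomorph ℂ P1 := annulusChart.toOpenPartialHomeomorph.trans
      (OnePoint.isOpenEmbedding_coe (X := ℂ)).toOpenPartialHomeomorph
    have hφ : ∀ z, φ z = ((annulusChart z : ℂ) : P1) := fun _ => rfl
    have himg : ∀ {x : P1}, x ∈ φ '' annulus ↔ ∃ w : ℂ, (w : P1) = x ∧
        annulusChart.symm w ∈ annulus := by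
      intro x
      constructor
      · rintro ⟨z, hz, rfl⟩
        exact ⟨annulusChart z, rfl, by rwa [annulusChart.symm_apply_apply]⟩
      · rintro ⟨w, rfl, hw⟩
        exact ⟨_, hw, by rw [hφ, annulusChart.apply_symm_apply]⟩
    refine ⟨φ, by simp [φ], fun z _ _ => ?_, ?_, ?_, fun z hz => ?_, fun x hx => ?_⟩
    · refine ⟨annulusChart z, rfl, ?_⟩
      filter_upwards [self_mem_nhdsWithin] with r hr
      have hr : 0 < r := hr
      -- The chart sends `z + r e^{it}` to `φ z + (2/3) r e^{it}`.
      refine ⟨fun t => ((Real.log (2 / 3 * r) : ℝ) : ℂ) + t * Complex.I, by fun_prop,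
        fun t => ?_, fun t => ?_⟩
      · rw [hφ]
        congr 1
        rw [Complex.exp_add, ← Complex.ofReal_exp, Real.exp_log (by positivity),
          annulusChart_apply, annulusChart_apply, circleMap]
        push_cast
        ring
      · push_cast
        ring
    · rw [boundaryCurve, frontier_closedBall _ one_ne_zero]
      ext x
      constructor
      · rintro ⟨z, hz, rfl⟩
        refine ⟨annulusChart z, ?_, rfl⟩
        rw [mem_sphere_zero_iff_norm] at hz
        rw [mem_sphere_iff_norm, annulusChart_apply, add_sub_cancel_left, norm_mul, hz]
        norm_num
      · rintro ⟨w, hw, rfl⟩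
        refine ⟨annulusChart.symm w, ?_, by rw [hφ, annulusChart.apply_symm_apply]⟩
        rw [mem_sphere_iff_norm] at hw
        rw [mem_sphere_zero_iff_norm, norm_annulusChart_symm, hw, mul_one]
    · rw [disjoint_left]
      intro x hx hxP
      obtain ⟨w, rfl, hw⟩ := himg.1 hx
      refine annulusChart_symm_notMem ?_ hw
      rw [Pf_eq] at hxP
      simpa using hxP
    · rw [hφ, hφ, ← fullTwist_of_mem_annulus hz]
      change ((dehnTwistPlane (annulusChart z) : ℂ) : P1) = _
      rw [dehnTwistPlane_apply, annulusChart.symm_apply_apply]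
    · induction x using OnePoint.rec with
      | infty => rfl
      | coe w =>
        refine congrArg _ (dehnTwistPlane_eq_self fun h => hx (himg.2 ⟨w, rfl, h⟩))

/-! ### Degrees of self-maps of the punctured plane -/

/-- A continuous self-map of the punctured plane lifts to its universal cover. -/
theorem exists_lift_exp {ψ : ℂ → ℂ} (hψ : ContinuousOn ψ {0}ᶜ) (h0 : ∀ z ≠ 0, ψ z ≠ 0) :
    ∃ (Ψ : ℂ → ℂ) (k : ℤ), Continuous Ψ ∧ (∀ z, Complex.exp (Ψ z) = ψ (Complex.exp z)) ∧
      ∀ (z : ℂ) (n : ℤ), Ψ (z + n * (2 * π * Complex.I)) = Ψ z + n * (k * (2 * π * Complex.I)) := by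
  obtain ⟨Ψ, hΨ, he⟩ := exists_continuous_log (u := fun z => ψ (Complex.exp z))
    (hψ.comp_continuous Complex.continuous_exp fun z => Complex.exp_ne_zero z)
    (fun z => h0 _ (Complex.exp_ne_zero z))
  have hexp : ∀ z, Complex.exp (Ψ (z + 2 * π * Complex.I) - Ψ z) = 1 := fun z => by
    rw [Complex.exp_sub, he, he, Complex.exp_periodic z, ← he, div_self (Complex.exp_ne_zero _)]
  have hconst := eq_of_continuous_of_forall_exp_eq_one
    (m := fun z => Ψ (z + 2 * π * Complex.I) - Ψ z) (by fun_prop) hexp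
  obtain ⟨k, hk⟩ := Complex.exp_eq_one_iff.1 (hexp 0)
  have hstep : ∀ z, Ψ (z + 2 * π * Complex.I) = Ψ z + k * (2 * π * Complex.I) := fun z => by
    have := hconst z 0
    linear_combination this + hk
  refine ⟨Ψ, k, hΨ, he, fun z n => ?_⟩
  induction n using Int.induction_on with
  | zero => simp
  | succ n ih =>
    have := hstep (z + (n : ℤ) * (2 * π * Complex.I))
    rw [ih] at this
    push_cast at this ⊢
    rw [add_mul, one_mul, ← add_assoc, this]
    ring
  | pred n ih =>
    have := hstep (z + ((-n - 1 : ℤ) : ℂ) * (2 * π * Complex.I))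
    have e : z + ((-n - 1 : ℤ) : ℂ) * (2 * π * Complex.I) + 2 * π * Complex.I =
        z + ((-n : ℤ) : ℂ) * (2 * π * Complex.I) := by
      push_cast
      ring
    rw [e, ih] at this
    push_cast at this ⊢
    linear_combination -this

/-- A self-map of the punctured plane with a homotopy left inverse has odd degree. -/
theorem odd_degree_of_comp {ψ ψ' : ℂ → ℂ} (hψ : ContinuousOn ψ {0}ᶜ) (h0 : ∀ z ≠ 0, ψ z ≠ 0)
    (hψ' : ContinuousOn ψ' {0}ᶜ) (h0' : ∀ z ≠ 0, ψ' z ≠ 0)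
    (h : HasLogVariation (0 : unitInterval) 1
      (fun s => ψ' (ψ (Complex.exp ((s : ℝ) * (2 * π * Complex.I))))) (2 * π * Complex.I)) :
    ∃ k : ℤ, Odd k ∧ HasLogVariation (0 : unitInterval) 1
      (fun s => ψ (Complex.exp ((s : ℝ) * (2 * π * Complex.I)))) (k * (2 * π * Complex.I)) := by
  obtain ⟨Ψ, k, hΨ, he, hk⟩ := exists_lift_exp hψ h0
  obtain ⟨Ψ', k', hΨ', he', hk'⟩ := exists_lift_exp hψ' h0'
  have e1 : Ψ (2 * π * Complex.I) = Ψ 0 + k * (2 * π * Complex.I) := by simpa using hk 0 1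
  have h1 : HasLogVariation (0 : unitInterval) 1
      (fun s => ψ' (ψ (Complex.exp ((s : ℝ) * (2 * π * Complex.I)))))
      (k * (k' * (2 * π * Complex.I))) :=
    ⟨fun s => Ψ' (Ψ ((s : ℝ) * (2 * π * Complex.I))), by fun_prop, fun s => by rw [he', he], by
      simp [e1, hk']⟩
  have h2 := h1.unique h
  -- Degrees multiply, so `k` is a unit of `ℤ`, in particular odd.
  have h3 : ((k * k' : ℤ) : ℂ) = 1 := by
    have := Complex.two_pi_I_ne_zero
    push_cast
    exact mul_right_cancel₀ this (by linear_combination h2)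
  have h4 : k * k' = 1 := by exact_mod_cast h3
  refine ⟨k, ?_, fun s => Ψ ((s : ℝ) * (2 * π * Complex.I)), by fun_prop, fun s => he _, by
    simp [e1]⟩
  exact (Int.odd_mul.1 (h4 ▸ odd_one)).1

/-! ### Variation of the argument under a Dehn twist -/

/-- Polar coordinates on the annulus `1 ≤ |z| ≤ 2`. -/
noncomputable def annulusPolar (q : ℝ × ℝ) : ℂ :=
  ((max 1 (min q.1 2) : ℝ) : ℂ) * Complex.exp (q.2 * Complex.I)

theorem norm_annulusPolar (q : ℝ × ℝ) : ‖annulusPolar q‖ = max 1 (min q.1 2) := by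
  rw [annulusPolar, norm_mul, Complex.norm_exp_ofReal_mul_I, mul_one, Complex.norm_real,
    Real.norm_of_nonneg (zero_le_one.trans (le_max_left _ _))]

theorem annulusPolar_mem (q : ℝ × ℝ) : annulusPolar q ∈ annulus := by
  rw [annulus, mem_ofPred_eq, norm_annulusPolar]
  exact ⟨le_max_left _ _, max_le one_le_two (min_le_right _ _)⟩

theorem continuous_annulusPolar : Continuous annulusPolar := by
  unfold annulusPolar
  fun_prop

theorem exists_annulusPolar {z : ℂ} (hz : z ∈ annulus) : ∃ θ, annulusPolar (‖z‖, θ) = z := by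
  refine ⟨z.arg, ?_⟩
  rw [annulusPolar, min_eq_left hz.2, max_eq_right hz.1, Complex.norm_mul_exp_arg_mul_I]

theorem annulusPolar_add_two_pi (r θ : ℝ) : annulusPolar (r, θ + 2 * π) = annulusPolar (r, θ) := by
  simp only [annulusPolar]
  push_cast
  rw [add_mul, Complex.exp_periodic]

/-- In polar coordinates the twist is a shear of the plane, trivial at `r = 1` and a shift by `-2π`
at `r = 2`. -/
theorem stdRightTwist_annulusPolar (r θ : ℝ) :
    stdRightTwist (annulusPolar (r, θ)) =
      annulusPolar (r, θ - 2 * π * (max 1 (min r 2) - 1)) := by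
  rw [stdRightTwist, norm_annulusPolar, annulusPolar, annulusPolar, mul_assoc, ← Complex.exp_add]
  push_cast
  ring_nf

section Twist

variable {φ : OpenPartialHomeomorph ℂ ℂ} {Φ : ℂ ≃ₜ ℂ}

/-- The core curve of an annulus winds an odd number of times around the points that it encloses. -/
theorem odd_winding_core (hs : annulus ⊆ φ.source)
    (hcore : φ '' Metric.sphere 0 (3 / 2) = Φ '' Metric.sphere 0 1)
    (h0 : ∀ z ∈ annulus, φ z ≠ 0) (hΦ0 : ‖Φ.symm 0‖ < 1) :
    ∃ k : ℤ, Odd k ∧ HasLogVariation (0 : unitInterval) 1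
      (fun s => φ (annulusPolar (3 / 2, s * (2 * π)))) (k * (2 * π * Complex.I)) := by
  have hsph : Metric.sphere (0 : ℂ) (3 / 2) ⊆ annulus := fun z hz => by
    rw [mem_sphere_zero_iff_norm] at hz
    constructor <;> rw [hz] <;> norm_num
  have hunit : ∀ z : ℂ, z ≠ 0 → ((3 / 2 : ℝ) : ℂ) * (z / ‖z‖) ∈ Metric.sphere (0 : ℂ) (3 / 2) := by
    intro z hz
    rw [mem_sphere_zero_iff_norm, norm_mul, norm_div, Complex.norm_real, Complex.norm_real,
      norm_norm, div_self (norm_ne_zero_iff.2 hz)]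
    norm_num
  have hunit1 : ∀ z : ℂ, z ≠ 0 → z / ‖z‖ ∈ Metric.sphere (0 : ℂ) 1 := by
    intro z hz
    rw [mem_sphere_zero_iff_norm, norm_div, Complex.norm_real,
      norm_norm, div_self (norm_ne_zero_iff.2 hz)]
  have hcunit : ContinuousOn (fun z : ℂ => z / ‖z‖) {0}ᶜ :=
    continuousOn_id.div (by fun_prop) fun z hz => by simpa using hz
  set ψ : ℂ → ℂ := fun z => φ (((3 / 2 : ℝ) : ℂ) * (z / ‖z‖)) with hψdef
  have hψ : ContinuousOn ψ {0}ᶜ :=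
    φ.continuousOn.comp (continuousOn_const.mul hcunit) fun z hz => hs (hsph (hunit z hz))
  have hψ0 : ∀ z ≠ 0, ψ z ≠ 0 := fun z hz => h0 _ (hsph (hunit z hz))
  set ω : ℂ → ℂ := fun x => φ.symm (Φ (x / ‖x‖)) with hωdef
  have hωmem : ∀ x : ℂ, x ≠ 0 → Φ (x / ‖x‖) ∈ φ '' Metric.sphere 0 (3 / 2) := fun x hx => by
    rw [hcore]
    exact mem_image_of_mem _ (hunit1 x hx)
  have hω : ContinuousOn ω {0}ᶜ := by
    refine φ.symm.continuousOn.comp (Φ.continuous.comp_continuousOn hcunit) fun x hx => ?_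
    obtain ⟨z, hz, hzx⟩ := hωmem x hx
    change Φ (x / ‖x‖) ∈ φ.target
    rw [← hzx]
    exact φ.map_source (hs (hsph hz))
  have hω0 : ∀ x ≠ 0, ω x ≠ 0 := by
    intro x hx h
    obtain ⟨z, hz, hzx⟩ := hωmem x hx
    simp only [hωdef] at h
    rw [← hzx, φ.left_inv (hs (hsph hz))] at h
    rw [h] at hz
    norm_num at hz
  have hψnorm : ∀ z ≠ 0, ‖Φ.symm (ψ z)‖ = 1 := fun z hz => by
    have : ψ z ∈ Φ '' Metric.sphere 0 1 := hcore ▸ mem_image_of_mem _ (hunit z hz)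
    obtain ⟨y, hy, hyz⟩ := this
    rw [← hyz, Φ.symm_apply_apply]
    simpa using hy
  have hv0 : ∀ (t : unitInterval) (z : ℂ), z ≠ 0 → Φ.symm (ψ z) - (t : ℝ) * Φ.symm 0 ≠ 0 := by
    intro t z hz h
    have h1 := hψnorm z hz
    rw [sub_eq_zero.1 h, norm_mul, Complex.norm_real, Real.norm_of_nonneg t.2.1] at h1
    nlinarith [t.2.1, t.2.2, norm_nonneg (Φ.symm 0)]
  have hexpc : Continuous fun s : unitInterval =>
      Complex.exp ((s : ℝ) * (2 * π * Complex.I)) := by fun_prop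
  have hψe : Continuous fun s : unitInterval =>
      ψ (Complex.exp ((s : ℝ) * (2 * π * Complex.I))) :=
    hψ.comp_continuous hexpc fun s => Complex.exp_ne_zero _
  -- The centre of projection moves from `0` to `Φ⁻¹(0)` inside the unit disc, so it never meets the
  -- unit circle. At `t = 0` the composite is `z ↦ (3/2) z`, of degree one.
  have hfam := HasLogVariation.of_family (X := unitInterval) (Y := unitInterval) (y₀ := 0)
    (y₁ := 1) (k := 1) (c := 2 * π * Complex.I)
    (G := fun t s => ω (Φ.symm (ψ (Complex.exp ((s : ℝ) * (2 * π * Complex.I)))) -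
      (t : ℝ) * Φ.symm 0)) ?_ (fun t s => hω0 _ (hv0 t _ (Complex.exp_ne_zero _))) ?_ 0 1 ?_
  rotate_left
  · refine hω.comp_continuous ?_ fun q => hv0 _ _ (Complex.exp_ne_zero _)
    exact (Φ.symm.continuous.comp (hψe.comp continuous_snd)).sub (by fun_prop)
  · intro t
    simp [Complex.exp_two_pi_mul_I]
  · have h1 : HasLogVariation (0 : unitInterval) 1 (fun s : unitInterval =>
        ((3 / 2 : ℝ) : ℂ) * Complex.exp ((s : ℝ) * (2 * π * Complex.I))) (2 * π * Complex.I) := by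
      have := (HasLogVariation.const (y₀ := (0 : unitInterval)) (y₁ := 1)
        (a := ((3 / 2 : ℝ) : ℂ)) (by norm_num)).mul
        (⟨fun s : unitInterval => (s : ℝ) * (2 * π * Complex.I), by fun_prop, fun s => rfl, rfl⟩ :
          HasLogVariation (0 : unitInterval) 1
            (fun s : unitInterval => Complex.exp ((s : ℝ) * (2 * π * Complex.I))) _)
      simpa using this
    refine h1.congr fun s => ?_
    have hn := hψnorm _ (Complex.exp_ne_zero ((s : ℝ) * (2 * π * Complex.I)))
    have hn' : ‖Complex.exp ((s : ℝ) * (2 * π * Complex.I))‖ = 1 := by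
      have : ((s : ℝ) : ℂ) * (2 * π * Complex.I) = ((s * (2 * π) : ℝ) : ℂ) * Complex.I := by
        push_cast
        ring
      rw [this, Complex.norm_exp_ofReal_mul_I]
    simp only [hωdef, Icc.coe_zero, Complex.ofReal_zero, zero_mul, sub_zero, hn,
      Complex.ofReal_one, div_one, Φ.apply_symm_apply]
    simp only [hψdef, hn', Complex.ofReal_one, div_one]
    rw [φ.left_inv]
    refine hs (hsph ?_)
    rw [mem_sphere_zero_iff_norm, norm_mul, hn']
    norm_num
  obtain ⟨k, hk, hvar⟩ := odd_degree_of_comp (ψ := ψ) (ψ' := fun x => ω (Φ.symm x - Φ.symm 0))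
    hψ hψ0
    (hω.comp (Φ.symm.continuous.sub continuous_const).continuousOn fun x hx h =>
      hx (Φ.symm.injective (sub_eq_zero.1 h)))
    (fun x hx => hω0 _ fun h => hx (Φ.symm.injective (sub_eq_zero.1 h)))
    (hfam.congr fun s => by simp)
  refine ⟨k, hk, hvar.congr fun s => ?_⟩
  have e : ((s : ℝ) : ℂ) * (2 * π * Complex.I) = ((s * (2 * π) : ℝ) : ℂ) * Complex.I := by
    push_cast
    ring
  have e2 : max 1 (min (3 / 2 : ℝ) 2) = 3 / 2 := by norm_num
  simp only [hψdef, annulusPolar, e, Complex.norm_exp_ofReal_mul_I, e2, Complex.ofReal_one,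
    div_one]

/-- The set is the exponential of a half-plane. -/
theorem isPreconnected_norm_gt_one : IsPreconnected {z : ℂ | 1 < ‖z‖} := by
  have h : {z : ℂ | 1 < ‖z‖} = Complex.exp '' {z : ℂ | 0 < z.re} := by
    ext z
    simp only [mem_ofPred_eq, mem_image]
    constructor
    · intro hz
      refine ⟨Complex.log z, ?_, Complex.exp_log (norm_pos_iff.1 (zero_lt_one.trans hz))⟩
      rw [Complex.log_re]
      exact Real.log_pos hz
    · rintro ⟨w, hw, rfl⟩
      rw [Complex.norm_exp]
      exact Real.one_lt_exp_iff.2 hw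
  rw [h]
  exact (convex_halfSpace_re_gt 0).isPreconnected.image _ Complex.continuous_exp.continuousOn

/-- Let `X` be a connected set that meets an annulus only near one of its two boundary circles. A
function that is a logarithm of `1` off the interior of the annulus, with value `e` on that circle,
equals `e` on `X` off the annulus. -/
theorem eq_of_collar {X A B : Set ℂ} (hX : IsPreconnected X) (hA : IsClosed A) (hB : IsOpen B)
    (hBA : B ⊆ A) {ℓ : ℂ → ℂ} (hℓ : Continuous ℓ) (h1 : ∀ x ∉ B, Complex.exp (ℓ x) = 1) {e : ℂ}
    (he : Complex.exp e = 1) (hAB : ∀ x ∈ X ∩ A, x ∉ B → ℓ x = e) (hne : (X ∩ A).Nonempty)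
    {x : ℂ} (hx : x ∈ X) (hxA : x ∉ A) : ℓ x = e := by
  classical
  have hXs : PreconnectedSpace X := Subtype.preconnectedSpace hX
  -- Overwriting `ℓ` by `e` on the annulus gives a continuous logarithm of `1` on all of `X`. The
  -- two formulas agree where the closed sets `A` and `Bᶜ` overlap.
  let m : X → ℂ := fun y => if (y : ℂ) ∈ A then e else ℓ y
  have hm : Continuous m := by
    have hcov : ((↑) ⁻¹' A : Set X) ∪ ((↑) ⁻¹' Bᶜ : Set X) = univ := by
      refine eq_univ_of_forall fun y => ?_
      by_cases hy : (y : ℂ) ∈ A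
      · exact Or.inl hy
      · exact Or.inr fun hyB => hy (hBA hyB)
    rw [← continuousOn_univ, ← hcov]
    refine ContinuousOn.union_of_isClosed ?_ ?_ (hA.preimage continuous_subtype_val)
      (hB.isClosed_compl.preimage continuous_subtype_val)
    · exact continuousOn_const.congr fun y hy => if_pos hy
    · refine (hℓ.comp continuous_subtype_val).continuousOn.congr fun y hy => ?_
      by_cases hyA : (y : ℂ) ∈ A
      · simp only [m, if_pos hyA, Function.comp_apply]
        exact (hAB y ⟨y.2, hyA⟩ hy).symm
      · simp only [m, if_neg hyA, Function.comp_apply]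
  obtain ⟨y, hyX, hyA⟩ := hne
  have := eq_of_continuous_of_forall_exp_eq_one hm (fun y => by
    by_cases hyA : (y : ℂ) ∈ A
    · simp only [m, if_pos hyA, he]
    · simp only [m, if_neg hyA]
      exact h1 y fun hyB => hyA (hBA hyB)) ⟨x, hx⟩ ⟨y, hyX⟩
  simpa only [m, if_neg hxA, if_pos hyA] using this

/-- The two halves of an annulus lie on different sides of its core curve. -/
theorem annulus_sides (hs : annulus ⊆ φ.source)
    (hcore : φ '' Metric.sphere 0 (3 / 2) = Φ '' Metric.sphere 0 1) :
    (∀ z ∈ annulus, (‖z‖ < 3 / 2 ↔ ‖Φ.symm (φ z)‖ < 1) ∧ (3 / 2 < ‖z‖ ↔ 1 < ‖Φ.symm (φ z)‖)) ∨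
    (∀ z ∈ annulus, (‖z‖ < 3 / 2 ↔ 1 < ‖Φ.symm (φ z)‖) ∧ (3 / 2 < ‖z‖ ↔ ‖Φ.symm (φ z)‖ < 1)) := by
  have hiff : ∀ z ∈ annulus, ‖z‖ = 3 / 2 ↔ ‖Φ.symm (φ z)‖ = 1 := by
    intro z hz
    constructor
    · intro h
      have : φ z ∈ Φ '' Metric.sphere 0 1 := hcore ▸ mem_image_of_mem _ (by simpa using h)
      obtain ⟨y, hy, hyz⟩ := this
      rw [← hyz, Φ.symm_apply_apply]
      simpa using hy
    · intro h
      have : φ z ∈ φ '' Metric.sphere 0 (3 / 2) := by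
        rw [hcore]
        exact ⟨_, by simpa using h, Φ.apply_symm_apply _⟩
      obtain ⟨y, hy, hyz⟩ := this
      rw [mem_sphere_zero_iff_norm] at hy
      have hya : y ∈ annulus := ⟨by rw [hy]; norm_num, by rw [hy]; norm_num⟩
      rwa [← φ.injOn (hs hya) (hs hz) hyz]
  have hcont : Continuous fun q => Φ.symm (φ (annulusPolar q)) :=
    Φ.symm.continuous.comp (φ.continuousOn.comp_continuous continuous_annulusPolar
      fun q => hs (annulusPolar_mem q))
  -- A connected range of radii avoiding `3/2` sweeps out a connected set that misses the core,
  -- hence stays on one side.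
  have side : ∀ S : Set ℝ, _root_.IsPreconnected S → (∀ r ∈ S, max 1 (min r 2) ≠ 3 / 2) →
      (∀ r ∈ S, ∀ θ, ‖Φ.symm (φ (annulusPolar (r, θ)))‖ < 1) ∨
      (∀ r ∈ S, ∀ θ, 1 < ‖Φ.symm (φ (annulusPolar (r, θ)))‖) := by
    intro S hS hne
    have hpre : _root_.IsPreconnected (S ×ˢ (univ : Set ℝ)) := hS.prod isPreconnected_univ
    have himg := hpre.image _ hcont.norm.continuousOn
    have hn1 : ∀ x ∈ (fun q => ‖Φ.symm (φ (annulusPolar q))‖) '' S ×ˢ (univ : Set ℝ),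
        x ∈ Iio (1 : ℝ) ∪ Ioi 1 := by
      rintro _ ⟨q, hq, rfl⟩
      have hq1 : ‖Φ.symm (φ (annulusPolar q))‖ ≠ 1 := fun h => hne q.1 hq.1 <| by
        rw [← norm_annulusPolar]
        exact (hiff _ (annulusPolar_mem q)).2 h
      exact lt_or_gt_of_ne hq1
    rcases isPreconnected_iff_subset_of_disjoint.1 himg _ _ isOpen_Iio isOpen_Ioi hn1
      (by rw [Iio_inter_Ioi]; simp) with h | h
    · exact Or.inl fun r hr θ => h ⟨(r, θ), ⟨hr, trivial⟩, rfl⟩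
    · exact Or.inr fun r hr θ => h ⟨(r, θ), ⟨hr, trivial⟩, rfl⟩
  have hIn := side (Ico 1 (3 / 2)) isPreconnected_Ico fun r hr => by
    rw [min_eq_left (by linarith [hr.2]), max_eq_right hr.1]
    exact hr.2.ne
  have hOut := side (Ioc (3 / 2) 2) isPreconnected_Ioc fun r hr => by
    rw [min_eq_left hr.2, max_eq_right (by linarith [hr.1])]
    exact hr.1.ne'
  -- neighbourhoods of points of the core curve meet both sides
  have hopen : ∀ U : Set ℂ, IsOpen U → (Metric.sphere (0 : ℂ) 1 ⊆ closure U) →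
      ∃ z ∈ annulus, Φ.symm (φ z) ∈ U := by
    intro U hU hcl
    have h32 : ((3 / 2 : ℝ) : ℂ) ∈ annulus := by
      constructor <;> rw [Complex.norm_real] <;> norm_num
    have hn : ‖((3 / 2 : ℝ) : ℂ)‖ = 3 / 2 := by rw [Complex.norm_real]; norm_num
    have hnb : (fun z => Φ.symm (φ z)) '' annulus ∈ 𝓝 (Φ.symm (φ ((3 / 2 : ℝ) : ℂ))) := by
      have hann : annulus ∈ 𝓝 (((3 / 2 : ℝ) : ℂ)) := by
        have h1 : IsOpen {z : ℂ | 1 < ‖z‖ ∧ ‖z‖ < 2} :=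
          (isOpen_lt continuous_const continuous_norm).inter
            (isOpen_lt continuous_norm continuous_const)
        refine mem_of_superset (h1.mem_nhds ?_) fun z hz => ⟨hz.1.le, hz.2.le⟩
        change 1 < ‖((3 / 2 : ℝ) : ℂ)‖ ∧ ‖((3 / 2 : ℝ) : ℂ)‖ < 2
        rw [hn]
        norm_num
      rw [← image_image]
      exact Φ.symm.isOpenMap.image_mem_nhds (φ.image_mem_nhds (hs h32) hann)
    have hc := hcl (a := Φ.symm (φ ((3 / 2 : ℝ) : ℂ))) (by
      rw [mem_sphere_zero_iff_norm]
      exact (hiff _ h32).1 hn)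
    obtain ⟨_, ⟨z, hz, rfl⟩, hzU⟩ := mem_closure_iff_nhds.1 hc _ hnb
    exact ⟨z, hz, hzU⟩
  obtain ⟨zi, hzi, hzi'⟩ := hopen (Metric.ball 0 1) Metric.isOpen_ball (by
    rw [closure_ball _ one_ne_zero]
    exact Metric.sphere_subset_closedBall)
  obtain ⟨zo, hzo, hzo'⟩ := hopen (Metric.closedBall 0 1)ᶜ Metric.isClosed_closedBall.isOpen_compl
    (by
      rw [closure_compl, interior_closedBall _ one_ne_zero]
      intro z hz hz'
      rw [mem_sphere_zero_iff_norm] at hz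
      rw [mem_ball_zero_iff] at hz'
      linarith)
  rw [mem_ball_zero_iff] at hzi'
  rw [mem_compl_iff, mem_closedBall_zero_iff, not_le] at hzo'
  have hIn' : (∀ z ∈ annulus, ‖z‖ < 3 / 2 → ‖Φ.symm (φ z)‖ < 1) ∨
      (∀ z ∈ annulus, ‖z‖ < 3 / 2 → 1 < ‖Φ.symm (φ z)‖) := by
    refine hIn.imp (fun h z hz hlt => ?_) fun h z hz hlt => ?_ <;>
    · obtain ⟨θ, hθ⟩ := exists_annulusPolar hz
      rw [← hθ]
      exact h _ ⟨hz.1, hlt⟩ θ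
  have hOut' : (∀ z ∈ annulus, 3 / 2 < ‖z‖ → ‖Φ.symm (φ z)‖ < 1) ∨
      (∀ z ∈ annulus, 3 / 2 < ‖z‖ → 1 < ‖Φ.symm (φ z)‖) := by
    refine hOut.imp (fun h z hz hlt => ?_) fun h z hz hlt => ?_ <;>
    · obtain ⟨θ, hθ⟩ := exists_annulusPolar hz
      rw [← hθ]
      exact h _ ⟨hlt, hz.2⟩ θ
  -- The halves cannot lie on the same side, since `zi` is inside the core curve and `zo` outside.
  rcases hIn' with h1 | h1 <;> rcases hOut' with h2 | h2
  · rcases lt_trichotomy ‖zo‖ (3 / 2) with h | h | h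
    · linarith [h1 zo hzo h]
    · linarith [(hiff zo hzo).1 h]
    · linarith [h2 zo hzo h]
  · left
    intro z hz
    have h3 := hiff z hz
    have h4 := h1 z hz
    have h5 := h2 z hz
    refine ⟨⟨h4, fun h => ?_⟩, h5, fun h => ?_⟩ <;> by_contra hcon
    · rcases (not_lt.1 hcon).eq_or_lt with h6 | h6
      · linarith [h3.1 h6.symm]
      · linarith [h5 h6]
    · rcases (not_lt.1 hcon).eq_or_lt with h6 | h6
      · linarith [h3.1 h6]
      · linarith [h4 h6]
  · right
    intro z hz
    have h3 := hiff z hz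
    have h4 := h1 z hz
    have h5 := h2 z hz
    refine ⟨⟨h4, fun h => ?_⟩, h5, fun h => ?_⟩ <;> by_contra hcon
    · rcases (not_lt.1 hcon).eq_or_lt with h6 | h6
      · linarith [h3.1 h6.symm]
      · linarith [h5 h6]
    · rcases (not_lt.1 hcon).eq_or_lt with h6 | h6
      · linarith [h3.1 h6]
      · linarith [h4 h6]
  · rcases lt_trichotomy ‖zi‖ (3 / 2) with h | h | h
    · linarith [h1 zi hzi h]
    · linarith [(hiff zi hzi).1 h]
    · linarith [h2 zi hzi h]

/-- A twist along an annulus that separates `0` and `1` from `-1` changes the variation of the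
argument along a path from `-1` to `1` by an odd multiple of `2π`. -/
theorem exists_log_twist (hs : annulus ⊆ φ.source)
    (hcore : φ '' Metric.sphere 0 (3 / 2) = Φ '' Metric.sphere 0 1)
    (hdisj : ∀ z ∈ annulus, φ z ∉ ({0, 1, -1} : Set ℂ)) {τ : ℂ → ℂ} (hτ : Continuous τ)
    (hτ0 : ∀ x ≠ 0, τ x ≠ 0) (htw : ∀ z ∈ annulus, τ (φ z) = φ (stdRightTwist z))
    (hid : ∀ x ∉ φ '' annulus, τ x = x) (h0 : ‖Φ.symm 0‖ < 1) (h1 : ‖Φ.symm 1‖ < 1)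
    (hm : 1 < ‖Φ.symm (-1)‖) :
    ∃ ℓ : ℂ → ℂ, Continuous ℓ ∧ (∀ x ≠ 0, Complex.exp (ℓ x) * x = τ x) ∧
      ∃ k : ℤ, Odd k ∧ ℓ 1 - ℓ (-1) = k * (2 * π * Complex.I) := by
  classical
  set A := φ '' annulus with hAdef
  have hcompact : IsCompact annulus := by
    have h2 : annulus = Metric.closedBall (0 : ℂ) 2 ∩ {z | 1 ≤ ‖z‖} := by
      ext z
      simp [annulus, and_comm]
    rw [h2]
    exact (isCompact_closedBall _ _).inter_right (isClosed_le continuous_const continuous_norm)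
  have hA : IsClosed A := (hcompact.image_of_continuousOn (φ.continuousOn.mono hs)).isClosed
  have hφ0 : ∀ z ∈ annulus, φ z ≠ 0 := fun z hz h => hdisj z hz (by simp [h])
  have hA0 : (0 : ℂ) ∉ A := by
    rintro ⟨z, hz, h⟩
    exact hφ0 z hz h
  -- a logarithm of `τ x / x`
  set u : ℂ → ℂ := fun x => if x = 0 then 1 else τ x / x with hu
  have hu1 : ∀ x ∉ A, u x = 1 := fun x hx => by
    by_cases h : x = 0
    · exact if_pos h
    · simp only [hu, if_neg h, hid x hx, div_self h]
  have huc : Continuous u := by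
    rw [continuous_iff_continuousAt]
    intro x
    by_cases hx : x = 0
    · subst hx
      refine continuousAt_const.congr (f := fun _ => (1 : ℂ)) ?_
      filter_upwards [hA.isOpen_compl.mem_nhds hA0] with y hy
      exact (hu1 y hy).symm
    · have : ContinuousAt (fun x => τ x / x) x := hτ.continuousAt.div continuousAt_id hx
      refine this.congr ?_
      filter_upwards [isOpen_ne.mem_nhds hx] with y hy
      exact (if_neg hy).symm
  have hu0 : ∀ x, u x ≠ 0 := fun x => by
    by_cases hx : x = 0
    · simp [hu, hx]
    · simp only [hu, if_neg hx]
      exact div_ne_zero (hτ0 x hx) hx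
  obtain ⟨ℓ, hℓ, heℓ⟩ := exists_continuous_log huc hu0
  have heτ : ∀ x ≠ 0, Complex.exp (ℓ x) * x = τ x := fun x hx => by
    rw [heℓ]
    simp only [hu, if_neg hx]
    exact div_mul_cancel₀ _ hx
  refine ⟨ℓ, hℓ, heτ, ?_⟩
  -- a logarithm in polar coordinates
  set F : ℝ × ℝ → ℂ := fun q => φ (annulusPolar q) with hFdef
  have hF : Continuous F := φ.continuousOn.comp_continuous continuous_annulusPolar
    fun q => hs (annulusPolar_mem q)
  have hF0 : ∀ q, F q ≠ 0 := fun q => hφ0 _ (annulusPolar_mem q)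
  obtain ⟨L, hL, heL⟩ := exists_continuous_log hF hF0
  obtain ⟨k, hk, hvar⟩ := odd_winding_core hs hcore hφ0 h0
  have hper : ∀ r θ, L (r, θ + 2 * π) - L (r, θ) = k * (2 * π * Complex.I) := by
    have hLk : L (3 / 2, 2 * π) - L (3 / 2, 0) = k * (2 * π * Complex.I) := by
      refine HasLogVariation.unique (Y := unitInterval) ?_ hvar
      exact ⟨fun s => L (3 / 2, s * (2 * π)), by fun_prop, fun s => heL _, by simp⟩
    intro r θ
    have := eq_of_continuous_of_forall_exp_eq_one
      (m := fun q : ℝ × ℝ => L (q.1, q.2 + 2 * π) - L q) (by fun_prop) (fun q => by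
        rw [Complex.exp_sub, heL, heL]
        simp only [hFdef, annulusPolar_add_two_pi]
        exact div_self (hF0 q)) (r, θ) (3 / 2, 0)
    simpa [hLk] using this
  -- Both `ℓ ∘ F` and the increment of `L` under the shear are logarithms of `τ(F)/F`. Comparing `r
  -- = 1` with `r = 2` shows that `ℓ` is constant on each boundary circle, with values differing by
  -- one period of `L`.
  have hdiff : ∀ q q' : ℝ × ℝ,
      ℓ (F q) - (L (q.1, q.2 - 2 * π * (max 1 (min q.1 2) - 1)) - L q) =
      ℓ (F q') - (L (q'.1, q'.2 - 2 * π * (max 1 (min q'.1 2) - 1)) - L q') := by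
    refine eq_of_continuous_of_forall_exp_eq_one
      (m := fun q : ℝ × ℝ =>
        ℓ (F q) - (L (q.1, q.2 - 2 * π * (max 1 (min q.1 2) - 1)) - L q)) (by fun_prop) fun q => ?_
    have h2 : τ (F q) = F (q.1, q.2 - 2 * π * (max 1 (min q.1 2) - 1)) := by
      simp only [hFdef]
      rw [htw _ (annulusPolar_mem q), stdRightTwist_annulusPolar]
    have h3 := heτ _ (hF0 q)
    rw [Complex.exp_sub, Complex.exp_sub, heL, heL, ← h2, ← h3]
    have := hF0 q
    have := Complex.exp_ne_zero (ℓ (F q))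
    field_simp
  have hinner : ∀ θ, ℓ (F (1, θ)) = ℓ (F (1, 0)) := fun θ => by
    have := hdiff (1, θ) (1, 0)
    simpa using this
  have houter : ∀ θ, ℓ (F (2, θ)) = ℓ (F (1, 0)) - k * (2 * π * Complex.I) := fun θ => by
    have := hdiff (2, θ) (1, 0)
    have h2 := hper 2 (θ - 2 * π)
    norm_num at this h2
    linear_combination this - h2
  -- the open annulus
  set B := φ '' {z | 1 < ‖z‖ ∧ ‖z‖ < 2} with hBdef
  have hBann : {z : ℂ | 1 < ‖z‖ ∧ ‖z‖ < 2} ⊆ annulus := fun z hz => ⟨hz.1.le, hz.2.le⟩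
  have hB : IsOpen B := by
    refine φ.isOpen_image_of_subset_source ?_ (hBann.trans hs)
    exact (isOpen_lt continuous_const continuous_norm).inter
      (isOpen_lt continuous_norm continuous_const)
  have hAB : ∀ z ∈ annulus, φ z ∉ B → ‖z‖ = 1 ∨ ‖z‖ = 2 := by
    intro z hz hzB
    by_contra! hcon
    exact hzB ⟨z, ⟨lt_of_le_of_ne hz.1 hcon.1.symm, lt_of_le_of_ne hz.2 hcon.2⟩, rfl⟩
  have hval1 : ∀ z ∈ annulus, ‖z‖ = 1 → ℓ (φ z) = ℓ (F (1, 0)) := fun z hz h => by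
    obtain ⟨θ, hθ⟩ := exists_annulusPolar hz
    rw [h] at hθ
    rw [← hθ]
    exact hinner θ
  have hval2 : ∀ z ∈ annulus, ‖z‖ = 2 → ℓ (φ z) = ℓ (F (1, 0)) - k * (2 * π * Complex.I) :=
    fun z hz h => by
      obtain ⟨θ, hθ⟩ := exists_annulusPolar hz
      rw [h] at hθ
      rw [← hθ]
      exact houter θ
  have hexp1 : Complex.exp (ℓ (F (1, 0))) = 1 := by
    refine mul_right_cancel₀ (hF0 (1, 0)) ?_
    rw [heτ _ (hF0 _), one_mul]
    simp only [hFdef]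
    rw [htw _ (annulusPolar_mem _), stdRightTwist_annulusPolar]
    norm_num
  have hexp2 : Complex.exp (ℓ (F (1, 0)) - k * (2 * π * Complex.I)) = 1 := by
    rw [Complex.exp_sub, hexp1, Complex.exp_int_mul_two_pi_mul_I, div_one]
  have hexpB : ∀ x ∉ B, Complex.exp (ℓ x) = 1 := by
    intro x hx
    by_cases hxA : x ∈ A
    · obtain ⟨z, hz, rfl⟩ := hxA
      rcases hAB z hz hx with h | h
      · rw [hval1 z hz h, hexp1]
      · rw [hval2 z hz h, hexp2]
    · rw [heℓ, hu1 x hxA]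
  have hBA : B ⊆ A := image_mono hBann
  have hX0 : IsPreconnected {x | ‖Φ.symm x‖ < 1} := by
    have : {x | ‖Φ.symm x‖ < 1} = Φ '' Metric.ball 0 1 := by
      rw [Φ.image_eq_preimage_symm]
      ext x
      simp
    rw [this]
    exact (convex_ball (0 : ℂ) 1).isPreconnected.image _ Φ.continuous.continuousOn
  have hX1 : IsPreconnected {x | 1 < ‖Φ.symm x‖} := by
    have : {x | 1 < ‖Φ.symm x‖} = Φ '' {z | 1 < ‖z‖} := by
      rw [Φ.image_eq_preimage_symm]
      rfl
    rw [this]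
    exact isPreconnected_norm_gt_one.image _ Φ.continuous.continuousOn
  have h1A : (1 : ℂ) ∉ A := by
    rintro ⟨z, hz, h⟩
    exact hdisj z hz (by simp [h])
  have hmA : (-1 : ℂ) ∉ A := by
    rintro ⟨z, hz, h⟩
    exact hdisj z hz (by simp [h])
  have hone : (1 : ℂ) ∈ annulus := by constructor <;> norm_num
  have htwo : (2 : ℂ) ∈ annulus := by constructor <;> norm_num
  have near : ∀ {X : Set ℂ}, IsPreconnected X → φ 1 ∈ X →
      (∀ z ∈ annulus, φ z ∈ X → ‖z‖ < 3 / 2) → ∀ x ∈ X, x ∉ A → ℓ x = ℓ (F (1, 0)) := by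
    intro X hX hX1 hXA x hx hxA
    refine eq_of_collar hX hA hB hBA hℓ hexpB hexp1 ?_ ⟨_, hX1, mem_image_of_mem _ hone⟩ hx hxA
    rintro _ ⟨hyX, z, hz, rfl⟩ hyB
    refine hval1 z hz ((hAB z hz hyB).resolve_right fun h => ?_)
    linarith [hXA z hz hyX]
  have far : ∀ {X : Set ℂ}, IsPreconnected X → φ 2 ∈ X →
      (∀ z ∈ annulus, φ z ∈ X → 3 / 2 < ‖z‖) → ∀ x ∈ X, x ∉ A →
      ℓ x = ℓ (F (1, 0)) - k * (2 * π * Complex.I) := by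
    intro X hX hX2 hXA x hx hxA
    refine eq_of_collar hX hA hB hBA hℓ hexpB hexp2 ?_ ⟨_, hX2, mem_image_of_mem _ htwo⟩ hx hxA
    rintro _ ⟨hyX, z, hz, rfl⟩ hyB
    refine hval2 z hz ((hAB z hz hyB).resolve_left fun h => ?_)
    linarith [hXA z hz hyX]
  have n1 : ‖(1 : ℂ)‖ < 3 / 2 := by norm_num
  have n2 : 3 / 2 < ‖(2 : ℂ)‖ := by norm_num
  -- The parametrization may turn the annulus inside out, which only changes the sign of `k`.
  rcases annulus_sides hs hcore with h | h
  · have e1 := near hX0 ((h 1 hone).1.1 n1) (fun z hz => (h z hz).1.2) 1 h1 h1A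
    have e2 := far hX1 ((h 2 htwo).2.1 n2) (fun z hz => (h z hz).2.2) (-1) hm hmA
    exact ⟨k, hk, by rw [e1, e2]; ring⟩
  · have e1 := near hX1 ((h 1 hone).1.1 n1) (fun z hz => (h z hz).1.2) (-1) hm hmA
    have e2 := far hX0 ((h 2 htwo).2.1 n2) (fun z hz => (h z hz).2.2) 1 h1 h1A
    exact ⟨-k, hk.neg, by rw [e1, e2]; push_cast; ring⟩

end Twist

/-! ### No lift of the Dehn twist is pure -/

/-- A right Dehn twist about the boundary of a regular neighbourhood of `[0,1]` changes the
variation of the argument along a path from `-1` to `1` by an odd multiple of `2π`. -/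
theorem exists_log_of_isRightDehnTwist {D : Set ℂ} (hD : IsRegularNhdUnitSegment D) {T : P1 ≃ₜ P1}
    (hTP : ∀ p ∈ Pf, T p = p) (hT : IsRightDehnTwist Pf (boundaryCurve D) T) {τ : ℂ → ℂ}
    (hτ : Continuous τ) (hτT : ∀ z : ℂ, T z = ((τ z : ℂ) : P1)) :
    ∃ ℓ : ℂ → ℂ, Continuous ℓ ∧ (∀ x ≠ 0, Complex.exp (ℓ x) * x = τ x) ∧
      ∃ k : ℤ, Odd k ∧ ℓ 1 - ℓ (-1) = k * (2 * π * Complex.I) := by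
  obtain ⟨⟨Φ, rfl⟩, hseg, hm⟩ := hD
  obtain ⟨φ, hs, -, hcore, hdisj, htw, hid⟩ := hT
  have hint : interior (Φ '' Metric.closedBall 0 1) = Φ '' Metric.ball 0 1 := by
    rw [← Φ.image_interior, interior_closedBall _ one_ne_zero]
  rw [hint] at hseg
  have hin : ∀ x ∈ Φ '' Metric.ball 0 1, ‖Φ.symm x‖ < 1 := by
    rintro _ ⟨z, hz, rfl⟩
    rw [Φ.symm_apply_apply]
    simpa using hz
  have hPmem : ∀ p ∈ ({0, 1, -1} : Set ℂ), (p : P1) ∈ Pf := by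
    rintro p (rfl | rfl | rfl) <;> simp [Pf_eq]
  have hPi : OnePoint.infty ∈ Pf := by simp [Pf_eq]
  let ι := (OnePoint.isOpenEmbedding_coe (X := ℂ)).toOpenPartialHomeomorph
  have hφfin : ∀ z ∈ annulus, ∃ w : ℂ, (w : P1) = φ z := fun z hz =>
    OnePoint.ne_infty_iff_exists.1 fun h =>
      hdisj.le_bot ⟨mem_image_of_mem _ hz, h ▸ hPi⟩
  -- The annulus misses `∞ ∈ P_f`, so the chart can be read in the plane.
  let φ' : OpenPartialHomeomorph ℂ ℂ := φ.trans ι.symm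
  have hιs : ∀ w : ℂ, ι.symm (w : P1) = w := fun w => ι.left_inv (x := w) trivial
  have hφ' : ∀ z ∈ annulus, ((φ' z : ℂ) : P1) = φ z := fun z hz => by
    obtain ⟨w, hw⟩ := hφfin z hz
    change ((ι.symm (φ z) : ℂ) : P1) = φ z
    rw [← hw, hιs]
  have hs' : annulus ⊆ φ'.source := fun z hz => by
    refine ⟨hs hz, ?_⟩
    obtain ⟨w, hw⟩ := hφfin z hz
    change φ z ∈ ι.target
    rw [← hw]
    exact ι.map_source (x := w) trivial
  have hsph : Metric.sphere (0 : ℂ) (3 / 2) ⊆ annulus := fun z hz => by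
    rw [mem_sphere_zero_iff_norm] at hz
    constructor <;> rw [hz] <;> norm_num
  have hcore' : φ' '' Metric.sphere 0 (3 / 2) = Φ '' Metric.sphere 0 1 := by
    apply OnePoint.coe_injective.image_injective
    rw [boundaryCurve, ← Φ.image_frontier, frontier_closedBall _ one_ne_zero] at hcore
    rw [← hcore, image_image]
    exact image_congr fun z hz => hφ' z (hsph hz)
  have htwmem : ∀ z ∈ annulus, stdRightTwist z ∈ annulus := fun z hz => by
    have : ‖stdRightTwist z‖ = ‖z‖ := by
      rw [← fullTwist_of_mem_annulus hz, norm_fullTwist]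
    rwa [annulus, mem_ofPred_eq, this]
  refine exists_log_twist hs' hcore' (fun z hz h => ?_) hτ (fun x hx h => ?_) (fun z hz => ?_)
    (fun x hx => ?_) (hin 0 (hseg (left_mem_segment ℝ _ _)))
    (hin 1 (hseg (right_mem_segment ℝ _ _))) ?_
  · exact hdisj.le_bot ⟨mem_image_of_mem _ hz, hφ' z hz ▸ hPmem _ h⟩
  · refine hx (OnePoint.coe_injective (T.injective ?_))
    rw [hτT, h, hTP _ (hPmem 0 (by simp))]
  · apply OnePoint.coe_injective
    rw [← hτT, hφ' z hz, htw z hz, hφ' _ (htwmem z hz)]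
  · apply OnePoint.coe_injective
    rw [← hτT]
    refine hid _ ?_
    rintro ⟨z, hz, h⟩
    exact hx ⟨z, hz, OnePoint.coe_injective ((hφ' z hz).trans h)⟩
  · by_contra h
    exact hm ⟨Φ.symm (-1), by simpa using h, Φ.apply_symm_apply _⟩

/-- No lift under the quartic of a homeomorphism in the class of a right Dehn twist about the
boundary of a regular neighbourhood of `[0,1]` is a pure homeomorphism. -/
theorem not_pure_lift {D : Set ℂ} (hD : IsRegularNhdUnitSegment D) {T h₀ k : pureHomeo Pf}
    (hT : IsRightDehnTwist Pf (boundaryCurve D) (T : P1 ≃ₜ P1))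
    (hclass : mappingClass Pf h₀ = mappingClass Pf T)
    (hk : ∀ x, (h₀ : P1 ≃ₜ P1) (quartic x) = quartic ((k : P1 ≃ₜ P1) x)) : False := by
  have hPmem : ∀ p ∈ ({0, 1, -1} : Set ℂ), (p : P1) ∈ Pf := by
    rintro p (rfl | rfl | rfl) <;> simp [Pf_eq]
  have hPi : OnePoint.infty ∈ Pf := by simp [Pf_eq]
  have fin : ∀ {h : P1 → P1}, Function.Injective h → h OnePoint.infty = OnePoint.infty →
      ∀ z : ℂ, h z ≠ OnePoint.infty := fun hinj hi z hz =>
    OnePoint.coe_ne_infty z (hinj (hz.trans hi.symm))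
  obtain ⟨H, hH⟩ : ∃ H, IsIsotopyFromId Pf ((T⁻¹ * h₀ : pureHomeo Pf) : P1 ≃ₜ P1) H :=
    QuotientGroup.eq.1 hclass.symm
  have hTH : ∀ x, (T : P1 ≃ₜ P1) (H (1, x)) = (h₀ : P1 ≃ₜ P1) x := fun x => by
    rw [hH.one]
    exact (T : P1 ≃ₜ P1).apply_symm_apply _
  -- the path `f([0,1])` from `-1` to `1`
  set α : unitInterval → ℂ := fun s => 2 * Complex.I * (((s : ℝ) : ℂ) ^ 2 - kappa) ^ 2 with hα
  have hαc : Continuous α := by fun_prop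
  have hαq : ∀ s : unitInterval, ((α s : ℂ) : P1) = quartic (((s : ℝ) : ℂ) : P1) := fun _ => rfl
  -- `s²` is real, while `κ` has imaginary part `1/2`.
  have hx0 : ∀ s : unitInterval, ((s : ℝ) : ℂ) ^ 2 - kappa ≠ 0 := fun s h => by
    have := congrArg Complex.im h
    rw [Complex.sub_im, kappa_im, ← Complex.ofReal_pow, Complex.ofReal_im] at this
    norm_num at this
  have hα0 : ∀ s, α s ≠ 0 := fun s => mul_ne_zero two_mul_I_ne_zero (pow_ne_zero 2 (hx0 s))
  have hαs : α 0 = -1 := OnePoint.coe_injective (by rw [hαq]; simpa using quartic_zero)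
  have hαt : α 1 = 1 := OnePoint.coe_injective (by rw [hαq]; simpa using quartic_one)
  -- the twist of the plane
  obtain ⟨τ, hτ, hτT⟩ := exists_continuous_coe_eq
    ((T : P1 ≃ₜ P1).continuous.comp OnePoint.continuous_coe)
    (fin (T : P1 ≃ₜ P1).injective (T.2.2 _ hPi))
  obtain ⟨ℓ, hℓ, heℓ, n, hn, hvar⟩ := exists_log_of_isRightDehnTwist hD T.2.2 hT hτ
    fun z => (hτT z).symm
  -- the isotopy moves the twisted path without changing the variation of its argument
  obtain ⟨M, hM, hMH⟩ := exists_continuous_coe_eq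
    (u := fun q : unitInterval × unitInterval => (T : P1 ≃ₜ P1) (H (q.1, (α q.2 : P1))))
    ((T : P1 ≃ₜ P1).continuous.comp (hH.continuous.comp
      (continuous_fst.prodMk (OnePoint.continuous_coe.comp (hαc.comp continuous_snd)))))
    (fun q => fin ((T : P1 ≃ₜ P1).injective.comp (hH.homeo q.1).injective)
      (by simp only [Function.comp_apply, hH.fixes _ _ hPi, T.2.2 _ hPi]) _)
  have hM0 : ∀ q, M q ≠ 0 := fun q h => hα0 q.2 <| OnePoint.coe_injective <|
    (hH.homeo q.1).injective <| (T : P1 ≃ₜ P1).injective <| by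
      have h0 := hPmem 0 (by simp)
      rw [← hMH, h, hH.fixes _ _ h0, T.2.2 _ h0]
  have hMend : ∀ t (s : unitInterval), α s ∈ ({0, 1, -1} : Set ℂ) → M (t, s) = α s :=
    fun t s h => OnePoint.coe_injective <| by
      rw [hMH, hH.fixes _ _ (hPmem _ h), T.2.2 _ (hPmem _ h)]
  have hM00 : ∀ t, M (t, 0) = α 0 := fun t => hMend t 0 (by simp [hαs])
  have hM11 : ∀ t, M (t, 1) = α 1 := fun t => hMend t 1 (by simp [hαt])
  -- At `t = 0` the ratio is `τ(α)/α` with logarithm `ℓ ∘ α`. At `t = 1` it is `h₀(α)/α`.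
  have hfam := HasLogVariation.of_family (X := unitInterval) (Y := unitInterval) (y₀ := 0)
    (y₁ := 1) (k := 1) (c := n * (2 * π * Complex.I)) (G := fun t s => M (t, s) / α s)
    (hM.div (hαc.comp continuous_snd) fun q => hα0 _)
    (fun t s => div_ne_zero (hM0 _) (hα0 _))
    (fun t => by simp only [hM00, hM11, div_self (hα0 _), mul_one]) 0 1
    ⟨fun s => ℓ (α s), hℓ.comp hαc, fun s => by
      have h1 : M (0, s) = τ (α s) := OnePoint.coe_injective (by rw [hMH, hH.zero, hτT]; rfl)
      simp only [h1]
      rw [← heℓ _ (hα0 s), mul_div_cancel_right₀ _ (hα0 s)], by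
      simp only [hαs, hαt, hvar]⟩
  -- the lift
  obtain ⟨y, hy, hyk⟩ := exists_continuous_coe_eq
    ((k : P1 ≃ₜ P1).continuous.comp (OnePoint.continuous_coe.comp
      (by fun_prop : Continuous fun s : unitInterval => ((s : ℝ) : ℂ))))
    (fun s => fin (k : P1 ≃ₜ P1).injective (k.2.2 _ hPi) _)
  have hy0 : y 0 = 0 := OnePoint.coe_injective <| (hyk 0).trans <| by
    simpa using k.2.2 _ (hPmem 0 (by simp))
  have hy1 : y 1 = 1 := OnePoint.coe_injective <| (hyk 1).trans <| by
    simpa using k.2.2 _ (hPmem 1 (by simp))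
  have hMy : ∀ s, M (1, s) = 2 * Complex.I * (y s ^ 2 - kappa) ^ 2 := fun s =>
    OnePoint.coe_injective <| by
      rw [hMH, hTH, hαq, hk, ← quartic_coe, hyk]
      rfl
  have hyne : ∀ s, y s ^ 2 - kappa ≠ 0 := fun s h => hM0 (1, s) (by rw [hMy, h]; ring)
  obtain ⟨m, hm, hme⟩ := exists_continuous_log_unitInterval
    (u := fun s => (y s ^ 2 - kappa) / (((s : ℝ) : ℂ) ^ 2 - kappa))
    ((by fun_prop : Continuous fun s => y s ^ 2 - kappa).div (by fun_prop) hx0)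
    (fun s => div_ne_zero (hyne s) (hx0 s))
  have hm' : HasLogVariation (0 : unitInterval) 1 _ (m 1 - m 0) := ⟨m, hm, hme, rfl⟩
  have hend : ∀ s : unitInterval, y s = ((s : ℝ) : ℂ) → Complex.exp (m s) = 1 := fun s hs => by
    rw [hme, hs, div_self (hx0 s)]
  obtain ⟨a, ha⟩ := Complex.exp_eq_one_iff.1 (hend 0 (by simp [hy0]))
  obtain ⟨b, hb⟩ := Complex.exp_eq_one_iff.1 (hend 1 (by simp [hy1]))
  -- The factors `2i` cancel and `h₀(α)/α` is the square of `exp ∘ m`, so its variation is twice a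
  -- multiple of `2πi`, against the odd `n`.
  have hdouble := ((hm'.mul hm').congr (v := fun s => M (1, s) / α s) fun s => by
    have := hx0 s
    have := two_mul_I_ne_zero
    rw [hMy, hα]
    field_simp).unique hfam
  rw [ha, hb] at hdouble
  have hcast : ((2 * (b - a) : ℤ) : ℂ) = n := by
    refine mul_right_cancel₀ Complex.two_pi_I_ne_zero ?_
    push_cast
    linear_combination hdouble
  have hint : 2 * (b - a) = n := by exact_mod_cast hcast
  exact (Int.not_even_iff_odd.2 hn) ⟨b - a, by rw [← hint]; ring⟩

theorem mainTheorem8 :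
    -- regular neighbourhoods `D` of `[0,1]` and right Dehn twists about `∂D` exist
    (∃ D : Set ℂ, IsRegularNhdUnitSegment D ∧
      ∃ T : pureHomeo Pf, IsRightDehnTwist Pf (boundaryCurve D) (T : P1 ≃ₜ P1)) ∧
    -- no lift under `f` of a homeomorphism in the class of such a twist is a pure homeomorphism
    (∀ D : Set ℂ, IsRegularNhdUnitSegment D →
      ∀ T : pureHomeo Pf, IsRightDehnTwist Pf (boundaryCurve D) (T : P1 ≃ₜ P1) →
      ∀ h₀ : pureHomeo Pf, mappingClass Pf h₀ = mappingClass Pf T →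
      ∀ h₁ : P1 → P1, (h₀ : P1 ≃ₜ P1) ∘ quartic = quartic ∘ h₁ →
        ¬ ∃ k : pureHomeo Pf, ⇑(k : P1 ≃ₜ P1) = h₁) ∧
    -- although `λ_f` is constant
    (∃ c, ∀ v, thurstonLinearMap quartic Pf v = c) := by
  refine ⟨exists_isRightDehnTwist, ?_, 0, fun v => by rw [thurstonLinearMap_quartic]; rfl⟩
  rintro D hD T hT h₀ hclass h₁ hlift ⟨k, rfl⟩
  exact not_pure_lift hD hT hclass (congrFun hlift)
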